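/- Let $K$ be a field of characteristic $0$ and let $\tau(x)\in K[[x_1,x_3,x_5,\dots]]$ be a nonzero formal power series in the variables $x=(x_1,x_3,x_5,\dots)$. Write $[\alpha]_{\rm o}=\left(\alpha,\frac{\alpha^3}{3},\frac{\alpha^5}{5},\dots\right)$ and $\tilde\xi(t,\lambda)=\sum_{n\ge1}t_{2n-1}\lambda^{2n-1}$. Then the following two conditions on $\tau$ are equivalent. (i) (Four term equation.) With $\alpha_{ij}=\alpha_i-\alpha_j$, $\tilde\alpha_{ij}=\alpha_i+\alpha_j$ and $A_{123}=\prod_{1\le i<j\le3}\tilde\alpha_{ij}/\alpha_{ij}$, $$\frac{\tau\big(x+2[\alpha_1]_{\rm o}+2[\alpha_2]_{\rm o}+2[\alpha_3]_{\rm o}\big)}{\tau(x)}=A_{123}\left\{\frac{\tau(x+2[\alpha_1]_{\rm o})}{\tau(x)}\frac{\alpha_{23}}{\tilde\alpha_{23}}\frac{\tau(x+2[\alpha_2]_{\rm o}+2[\alpha_3]_{\rm o})}{\tau(x)}-\frac{\tau(x+2[\alpha_2]_{\rm o})}{\tau(x)}\frac{\alpha_{13}}{\tilde\alpha_{13}}\frac{\tau(x+2[\alpha_1]_{\rm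 o}+2[\alpha_3]_{\rm o})}{\tau(x)}+\frac{\tau(x+2[\alpha_3]_{\rm o})}{\tau(x)}\frac{\alpha_{12}}{\tilde\alpha_{12}}\frac{\tau(x+2[\alpha_1]_{\rm o}+2[\alpha_2]_{\rm o})}{\tau(x)}\right\}$$ holds in the field of fractions of $K[[x_1,x_3,\dots,\alpha_1,\alpha_2,\alpha_3]]$. (ii) (BKP hierarchy.) With two independent sets of variables $t=(t_1,t_3,\dots)$ and $t'=(t'_1,t'_3,\dots)$, $$\oint e^{\tilde\xi(t-t',\lambda)}\,\tau\big(t-2[\lambda^{-1}]_{\rm o}\big)\,\tau\big(t'+2[\lambda^{-1}]_{\rm o}\big)\frac{d\lambda}{2\pi i\lambda}=\tau(t)\,\tau(t')$$ holds in $K[[t_1,t_3,\dots,t'_1,t'_3,\dots]]$, where $\oint\frac{d\lambda}{2\pi i}$ denotes the formal operator that extracts the coefficient of $\lambda^{-1}$ (here a sum which is finite in each monomial of $t,t'$). -/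

import Mathlib

namespace BKP

/-- The component of `[z]ₒ = (z, z ^ 3 / 3, z ^ 5 / 5, …)` which is added to the time `x_{2n+1}`,
namely `z ^ (2n+1) / (2n+1)`. -/
noncomputable def bracket {K : Type*} [Field K] {σ : Type*} (z : MvPowerSeries σ K) (n : ℕ) :
    MvPowerSeries σ K :=
  MvPowerSeries.C (1 / (2 * (n : K) + 1)) * z ^ (2 * n + 1)

/-- The ring of formal power series in two independent sets of times `t = (t₁, t₃, …)` and
`t' = (t'₁, t'₃, …)`. The index `Sum.inl n` stands for `t_{2n+1}`, and `Sum.inr n` for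
`t'_{2n+1}`. -/
abbrev TwoTimes (K : Type*) [Field K] : Type _ := MvPowerSeries (ℕ ⊕ ℕ) K

/-- `ξ̃(t - t', lam) = ∑ (t_{2n+1} - t'_{2n+1}) lam ^ (2n+1)`, as a power series in `lam`. -/
noncomputable def xi (K : Type*) [Field K] : PowerSeries (TwoTimes K) :=
  PowerSeries.mk fun m =>
    if Odd m then MvPowerSeries.X (Sum.inl (m / 2)) - MvPowerSeries.X (Sum.inr (m / 2)) else 0

/-- `exp (ξ̃(t - t', lam))`, as a power series in `lam`. -/
noncomputable def expXi (K : Type*) [Field K] [CharZero K] : PowerSeries (TwoTimes K) :=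
  (PowerSeries.exp K).subst (xi K)

/-- The arguments `t - 2[μ]ₒ`, where `μ = lam⁻¹` is the variable `none`. -/
noncomputable def argLeft (K : Type*) [Field K] (n : ℕ) : MvPowerSeries (Option (ℕ ⊕ ℕ)) K :=
  MvPowerSeries.X (some (Sum.inl n)) - 2 * bracket (MvPowerSeries.X none) n

/-- The arguments `t' + 2[μ]ₒ`, where `μ = lam⁻¹` is the variable `none`. -/
noncomputable def argRight (K : Type*) [Field K] (n : ℕ) : MvPowerSeries (Option (ℕ ⊕ ℕ)) K :=
  MvPowerSeries.X (some (Sum.inr n)) + 2 * bracket (MvPowerSeries.X none) n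

/-- `τ(t - 2[lam⁻¹]ₒ) τ(t' + 2[lam⁻¹]ₒ)`, as a power series in `lam⁻¹`. -/
noncomputable def tauTau {K : Type*} [Field K] (τ : MvPowerSeries ℕ K) :
    PowerSeries (TwoTimes K) :=
  MvPowerSeries.optionEquivLeft (ℕ ⊕ ℕ) K (τ.subst (argLeft K) * τ.subst (argRight K))

/-- The formal integral `∮ a(lam) b(lam⁻¹) dlam / (2πi lam)`, i.e. the coefficient of `lam ^ 0` in
the product of `a(lam) = ∑ a_k lam ^ k` and `b(lam⁻¹) = ∑ b_k lam ^ (-k)`, which is `∑ a_k b_k`.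
The sum is taken separately in each coefficient `d` with respect to the times. -/
noncomputable def residue {K : Type*} [Field K] {σ : Type*}
    (a b : PowerSeries (MvPowerSeries σ K)) : MvPowerSeries σ K :=
  fun d => ∑ᶠ k : ℕ, MvPowerSeries.coeff d (PowerSeries.coeff k a * PowerSeries.coeff k b)

/-- The BKP hierarchy for a formal power series `τ` in `x₁, x₃, x₅, …`, where the variable with
index `n` is `x_{2n+1}`:
`∮ exp (ξ̃(t - t', lam)) τ(t - 2[lam⁻¹]ₒ) τ(t' + 2[lam⁻¹]ₒ) dlam / (2πi lam) = τ(t) τ(t')`. -/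
def IsBKP {K : Type*} [Field K] [CharZero K] (τ : MvPowerSeries ℕ K) : Prop :=
  residue (expXi K) (tauTau τ) =
    τ.subst (fun n => (MvPowerSeries.X (Sum.inl n) : TwoTimes K)) *
      τ.subst (fun n => (MvPowerSeries.X (Sum.inr n) : TwoTimes K))

/-- The ring of formal power series in the times `x₁, x₃, …` and in three parameters
`α₁, α₂, α₃`. The index `Sum.inl n` stands for `x_{2n+1}`, and `Sum.inr i` for `α_{i+1}`. -/
abbrev ThreePoint (K : Type*) [Field K] : Type _ := MvPowerSeries (ℕ ⊕ Fin 3) K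

/-- The arguments `x + 2 ∑_{i ∈ S} [α_i]ₒ`. -/
noncomputable def argPoint (K : Type*) [Field K] (S : Finset (Fin 3)) (n : ℕ) : ThreePoint K :=
  MvPowerSeries.X (Sum.inl n) + 2 * ∑ i ∈ S, bracket (MvPowerSeries.X (Sum.inr i)) n

/-- The quotient `τ(x + 2 ∑_{i ∈ S} [α_i]ₒ) / τ(x)`, in the field of fractions. -/
noncomputable def ratio {K : Type*} [Field K] (τ : MvPowerSeries ℕ K) (S : Finset (Fin 3)) :
    FractionRing (ThreePoint K) :=
  algebraMap (ThreePoint K) (FractionRing (ThreePoint K)) (τ.subst (argPoint K S)) /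
    algebraMap (ThreePoint K) (FractionRing (ThreePoint K))
      (τ.subst fun n => (MvPowerSeries.X (Sum.inl n) : ThreePoint K))

/-- The quotient `(α_i - α_j) / (α_i + α_j)`. -/
noncomputable def coef (K : Type*) [Field K] (i j : Fin 3) : FractionRing (ThreePoint K) :=
  algebraMap (ThreePoint K) (FractionRing (ThreePoint K))
      (MvPowerSeries.X (Sum.inr i) - MvPowerSeries.X (Sum.inr j)) /
    algebraMap (ThreePoint K) (FractionRing (ThreePoint K))
      (MvPowerSeries.X (Sum.inr i) + MvPowerSeries.X (Sum.inr j))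

/-- The four term equation for `τ ≠ 0`, as an identity in the field of fractions of the ring of
formal power series in `x₁, x₃, …, α₁, α₂, α₃`. -/
def FourTermEquation {K : Type*} [Field K] (τ : MvPowerSeries ℕ K) : Prop :=
  ratio τ {0, 1, 2} =
    (coef K 0 1)⁻¹ * (coef K 0 2)⁻¹ * (coef K 1 2)⁻¹ *
      (ratio τ {0} * (coef K 1 2 * ratio τ {1, 2})
        - ratio τ {1} * (coef K 0 2 * ratio τ {0, 2})
        + ratio τ {2} * (coef K 0 1 * ratio τ {0, 1}))

/-! The substitutions and the sum in the definitions above are meaningful. -/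

theorem hasSubst_bracket {K : Type*} [Field K] {σ : Type*} {z : MvPowerSeries σ K}
    (hz : MvPowerSeries.constantCoeff z = 0) :
    MvPowerSeries.HasSubst (fun n => bracket z n) where
  const_coeff n := by simp [bracket, hz]
  coeff_zero d := by
    refine (Set.finite_Iic (Finsupp.degree d)).subset fun n hn => ?_
    by_contra h
    simp only [Set.mem_Iic, not_le] at h
    refine hn ?_
    have h1 : MvPowerSeries.coeff d (z ^ (2 * n + 1)) = 0 := by
      apply MvPowerSeries.coeff_of_lt_order
      refine lt_of_lt_of_le ?_ (MvPowerSeries.le_order_pow_of_constantCoeff_eq_zero _ hz)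
      exact_mod_cast (by omega : Finsupp.degree d < 2 * n + 1)
    simp [bracket, MvPowerSeries.coeff_C_mul, h1]

theorem hasSubst_X {K : Type*} [Field K] {σ : Type*} {f : ℕ → σ} (hf : Function.Injective f) :
    MvPowerSeries.HasSubst (fun n => (MvPowerSeries.X (f n) : MvPowerSeries σ K)) where
  const_coeff n := by simp
  coeff_zero d := by
    classical
    refine Set.Subsingleton.finite fun m hm n hn => ?_
    simp only [Set.mem_ofPred_eq, MvPowerSeries.coeff_X, ne_eq, ite_eq_right_iff, one_ne_zero,
      imp_false, not_not] at hm hn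
    exact hf (Finsupp.single_left_injective one_ne_zero (hm.symm.trans hn))

theorem hasSubst_argLeft (K : Type*) [Field K] : MvPowerSeries.HasSubst (argLeft K) := by
  have h := (hasSubst_X (K := K) (f := fun n => some (Sum.inl n : ℕ ⊕ ℕ))
    (fun a b h => by simpa using h)).add
    ((hasSubst_bracket (K := K) (MvPowerSeries.constantCoeff_X (none : Option (ℕ ⊕ ℕ)))).smul (-2))
  convert h using 1
  funext n
  simp [argLeft, sub_eq_add_neg]

theorem hasSubst_argRight (K : Type*) [Field K] : MvPowerSeries.HasSubst (argRight K) :=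
  (hasSubst_X (K := K) (f := fun n => some (Sum.inr n : ℕ ⊕ ℕ))
    (fun a b h => by simpa using h)).add
    ((hasSubst_bracket (K := K) (MvPowerSeries.constantCoeff_X (none : Option (ℕ ⊕ ℕ)))).smul 2)

theorem hasSubst_argPoint (K : Type*) [Field K] (S : Finset (Fin 3)) :
    MvPowerSeries.HasSubst (argPoint K S) := by
  have h1 : MvPowerSeries.HasSubst
      (∑ i ∈ S, fun n => bracket (MvPowerSeries.X (Sum.inr i) : ThreePoint K) n) :=
    Ideal.sum_mem MvPowerSeries.hasSubstIdeal
      fun i _ => hasSubst_bracket (MvPowerSeries.constantCoeff_X (Sum.inr i))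
  have h := (hasSubst_X (K := K) (f := fun n => (Sum.inl n : ℕ ⊕ Fin 3))
    Sum.inl_injective).add (h1.smul 2)
  convert h using 1
  funext n
  simp [argPoint]

theorem hasSubst_xi (K : Type*) [Field K] : PowerSeries.HasSubst (xi K) :=
  PowerSeries.HasSubst.of_constantCoeff_zero' (by
    rw [← PowerSeries.coeff_zero_eq_constantCoeff_apply]; simp [xi])

/-- The weight of `t_{2n+1}` and of `t'_{2n+1}` is `2n+1`. -/
def wt : ℕ ⊕ ℕ → ℕ := Sum.elim (fun n => 2 * n + 1) (fun n => 2 * n + 1)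

theorem le_weightedOrder_coeff_xi_pow (K : Type*) [Field K] (m k : ℕ) :
    (k : ℕ∞) ≤ (PowerSeries.coeff k (xi K ^ m)).weightedOrder wt := by
  classical
  induction m generalizing k with
  | zero =>
    rcases Nat.eq_zero_or_pos k with rfl | hk
    · simp
    · simp [PowerSeries.coeff_one, hk.ne']
  | succ m ih =>
    rw [pow_succ, PowerSeries.coeff_mul]
    refine MvPowerSeries.le_weightedOrder _ fun d hd => ?_
    rw [map_sum]
    refine Finset.sum_eq_zero fun p hp => ?_
    apply MvPowerSeries.coeff_eq_zero_of_lt_weightedOrder wt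
    refine lt_of_lt_of_le hd ?_
    refine le_trans ?_ (MvPowerSeries.le_weightedOrder_mul wt)
    have hxi : (p.2 : ℕ∞) ≤ (PowerSeries.coeff p.2 (xi K)).weightedOrder wt := by
      refine MvPowerSeries.le_weightedOrder _ fun e he => ?_
      rw [xi, PowerSeries.coeff_mk]
      split_ifs with ho
      · obtain ⟨q, hq⟩ := ho
        have hq2 : p.2 / 2 = q := by omega
        have key : ∀ s : ℕ ⊕ ℕ, wt s = p.2 →
            MvPowerSeries.coeff e (MvPowerSeries.X s : TwoTimes K) = 0 := by
          intro s hs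
          rw [MvPowerSeries.coeff_X, if_neg]
          rintro rfl
          rw [Finsupp.weight_single] at he
          simp [hs] at he
        rw [map_sub, hq2, key (Sum.inl q) hq.symm, key (Sum.inr q) hq.symm, sub_zero]
      · simp
    calc (k : ℕ∞) = (p.1 : ℕ∞) + p.2 := by
          rw [← Finset.HasAntidiagonal.mem_antidiagonal.mp hp]; push_cast; rfl
      _ ≤ _ := add_le_add (ih p.1) hxi

/-- The sum which defines the formal integral in the hierarchy is finite in each coefficient. -/
theorem finite_support_residue {K : Type*} [Field K] [CharZero K] (b : PowerSeries (TwoTimes K))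
    (d : ℕ ⊕ ℕ →₀ ℕ) :
    (Function.support fun k : ℕ => MvPowerSeries.coeff d
      (PowerSeries.coeff k (expXi K) * PowerSeries.coeff k b)).Finite := by
  refine (Set.finite_Iic (Finsupp.weight wt d)).subset fun k hk => ?_
  by_contra h
  simp only [Set.mem_Iic, not_le] at h
  refine hk ?_
  apply MvPowerSeries.coeff_eq_zero_of_lt_weightedOrder wt
  refine lt_of_lt_of_le (by exact_mod_cast h : ((Finsupp.weight wt d : ℕ) : ℕ∞) < k) ?_
  refine le_trans ?_ (MvPowerSeries.le_weightedOrder_mul wt)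
  refine le_trans ?_ le_self_add
  refine MvPowerSeries.le_weightedOrder _ fun e he => ?_
  rw [expXi, PowerSeries.coeff_subst' (hasSubst_xi K), finsum_eq_sum _
    (PowerSeries.coeff_subst_finite' (hasSubst_xi K) _ _), map_sum]
  refine Finset.sum_eq_zero fun m _ => ?_
  rw [MvPowerSeries.coeff_smul,
    MvPowerSeries.coeff_eq_zero_of_lt_weightedOrder wt
      (lt_of_lt_of_le he (le_weightedOrder_coeff_xi_pow K m k)), mul_zero]

end BKP

/-! Substitute t = x + 2 ∑_{i ∈ S} [α_i]ₒ and t' = x with |S| odd. Then exp ξ̃(t - t', λ) becomes ∏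
(1 + α_i λ) / (1 - α_i λ), whose partial fraction expansion is -1 + ∑_i 2 c_i / (1 - α_i λ) with c_i
= ∏_{j ≠ i} (α_i + α_j) / (α_i - α_j). Pairing 1 / (1 - z λ) with a series in λ⁻¹ evaluates that
series at λ⁻¹ = z. Writing T(S) for τ(x + 2 ∑_{i ∈ S} [α_i]ₒ), the hierarchy therefore specializes
to ∑_i c_i T(S \ i) T({i}) = T(S) T(∅), which is `PointRelation`
(`subst_eq_zero_iff_pointRelation`).

For |S| = 3 this is the four term equation (`fourTermEquation_iff`), so the hierarchy implies it.
Conversely, the four term equation may be shifted to any base point x + 2 ∑_{i ∈ Q} [α_i]ₒ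
(`FourTermEquation.shift`), and an induction of Plücker type yields the relation for every odd |S|
(`odd_point`). These specializations suffice: x_{2n+1} and x_{2n+1} + 2 ∑ α_i ^ (2n+1) / (2n+1), for
arbitrarily many α_i, satisfy no common polynomial relation (`eq_zero_of_aeval_polyTimes`), and
weighted homogeneity extends this to power series (`eq_zero_of_subst_argTimes`). -/

namespace BKP

/-! ### From three points to any odd number of points -/

section Algebra

variable {L ι : Type*} [Field L] [DecidableEq ι]

/-- Four-point relation deduced from the three-point relations with the same base. -/
theorem four_point {w : ι → ι → L} {T : Finset ι → L} (hw : ∀ i j, w i j = -w j i)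
    {Q : Finset ι} (hQ : T Q ≠ 0)
    (h3 : ∀ a b c, a ≠ b → a ≠ c → b ≠ c → a ∉ Q → b ∉ Q → c ∉ Q →
      T (insert a (insert b (insert c Q))) * T Q =
        w a b * w a c * (T (insert a Q) * T (insert b (insert c Q))) +
        w b a * w b c * (T (insert b Q) * T (insert a (insert c Q))) +
        w c a * w c b * (T (insert c Q) * T (insert a (insert b Q))))
    {i a b c : ι} (hia : i ≠ a) (hib : i ≠ b) (hic : i ≠ c) (hab : a ≠ b) (hac : a ≠ c)
    (hbc : b ≠ c) (hi : i ∉ Q) (ha : a ∉ Q) (hb : b ∉ Q) (hc : c ∉ Q) :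
    w i a * w i b * w i c * (T (insert i Q) * T (insert a (insert b (insert c Q)))) +
      w a i * w a b * w a c * (T (insert a Q) * T (insert b (insert c (insert i Q)))) +
      w b i * w b a * w b c * (T (insert b Q) * T (insert a (insert c (insert i Q)))) +
      w c i * w c a * w c b * (T (insert c Q) * T (insert a (insert b (insert i Q)))) = 0 := by
  -- After multiplication by `T Q`, each three-point shift expands into three terms; the resulting
  -- twelve terms cancel in pairs by antisymmetry of `w`.
  refine (mul_eq_zero.mp ?_).resolve_right hQ
  have e1 := h3 a b c hab hac hbc ha hb hc
  have e2 := h3 b c i hbc hib.symm hic.symm hb hc hi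
  have e3 := h3 a c i hac hia.symm hic.symm ha hc hi
  have e4 := h3 a b i hab hia.symm hib.symm ha hb hi
  rw [hw i a, hw i b, hw i c, hw b a, hw c a, hw c b] at *
  linear_combination (-w a i * -w b i * -w c i * T (insert i Q)) * e1 +
    w a i * w a b * w a c * T (insert a Q) * e2 +
    w b i * -w a b * w b c * T (insert b Q) * e3 +
    w c i * -w a c * -w b c * T (insert c Q) * e4

/-- The three-point relations imply the relations with any odd number of points. -/
theorem odd_point {w : ι → ι → L} {T : Finset ι → L} (hw : ∀ i j, w i j = -w j i)
    (hT : ∀ S, T S ≠ 0)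
    (h3 : ∀ Q a b c, a ≠ b → a ≠ c → b ≠ c → a ∉ Q → b ∉ Q → c ∉ Q →
      T (insert a (insert b (insert c Q))) * T Q =
        w a b * w a c * (T (insert a Q) * T (insert b (insert c Q))) +
        w b a * w b c * (T (insert b Q) * T (insert a (insert c Q))) +
        w c a * w c b * (T (insert c Q) * T (insert a (insert b Q))))
    (n : ℕ) (S : Finset ι) (hS : S.card = 2 * n + 1) :
    ∑ i ∈ S, (∏ j ∈ S.erase i, w i j) * (T (S.erase i) * T {i}) = T S * T ∅ := by
  induction n generalizing S with
  | zero =>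
    obtain ⟨i, rfl⟩ := Finset.card_eq_one.mp hS
    simp [mul_comm]
  | succ n ih =>
    obtain ⟨a, S₁, ha, rfl, hS₁⟩ := Finset.card_eq_succ.mp
      (show S.card = (2 * n + 2) + 1 by omega)
    obtain ⟨b, S₂, hb, rfl, hS₂⟩ := Finset.card_eq_succ.mp
      (show S₁.card = (2 * n + 1) + 1 by omega)
    obtain ⟨c, R, hc, rfl, hR⟩ := Finset.card_eq_succ.mp hS₂
    simp only [Finset.mem_insert, not_or] at ha hb
    obtain ⟨hab, hac, ha⟩ := ha
    obtain ⟨hbc, hb⟩ := hb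
    -- The induction hypothesis for R ∪ {p}, with the summand of p split off.
    have expand : ∀ p, p ∉ R → (∏ j ∈ R, w p j) * (T R * T {p}) +
        ∑ i ∈ R, w i p * (∏ j ∈ R.erase i, w i j) * (T (insert p (R.erase i)) * T {i}) =
          T (insert p R) * T ∅ := by
      intro p hp
      rw [← ih (insert p R) (by rw [Finset.card_insert_of_notMem hp, hR]),
        Finset.sum_insert hp, Finset.erase_insert hp]
      congr 1
      refine Finset.sum_congr rfl fun i hi => ?_
      have hpi : p ≠ i := fun h => hp (h ▸ hi)
      rw [Finset.erase_insert_of_ne hpi, Finset.prod_insert (by simp [hp])]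
    have ea := expand a ha
    have eb := expand b hb
    have ec := expand c hc
    have e3 := h3 R a b c hab hac hbc ha hb hc
    -- The four-point relation for i, a, b, c over R \ i: up to the factor `T R`, the summand of i
    -- for S is a combination of the summands of i for R ∪ {a}, R ∪ {b} and R ∪ {c}.
    have key : ∀ i ∈ R, (∏ j ∈ (insert a (insert b (insert c R))).erase i, w i j) *
          (T ((insert a (insert b (insert c R))).erase i) * T {i}) * T R =
        w a b * w a c * (w i a * (∏ j ∈ R.erase i, w i j) *
          (T (insert a (R.erase i)) * T {i})) * T (insert b (insert c R)) +
        w b a * w b c * (w i b * (∏ j ∈ R.erase i, w i j) *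
          (T (insert b (R.erase i)) * T {i})) * T (insert a (insert c R)) +
        w c a * w c b * (w i c * (∏ j ∈ R.erase i, w i j) *
          (T (insert c (R.erase i)) * T {i})) * T (insert a (insert b R)) := by
      intro i hi
      have hai : a ≠ i := fun h => ha (h ▸ hi)
      have hbi : b ≠ i := fun h => hb (h ▸ hi)
      have hci : c ≠ i := fun h => hc (h ▸ hi)
      have e4 := four_point hw (hT (R.erase i)) (h3 (R.erase i)) hai.symm hbi.symm hci.symm
        hab hac hbc (by simp) (by simp [ha]) (by simp [hb]) (by simp [hc])
      rw [Finset.insert_erase hi] at e4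
      rw [Finset.erase_insert_of_ne hai, Finset.erase_insert_of_ne hbi,
        Finset.erase_insert_of_ne hci, Finset.prod_insert (by simp [hab, hac, ha]),
        Finset.prod_insert (by simp [hbc, hb]), Finset.prod_insert (by simp [hc])]
      rw [hw a i, hw b i, hw c i] at e4
      linear_combination (∏ j ∈ R.erase i, w i j) * T {i} * e4
    have hsum := Finset.sum_congr rfl key
    simp only [Finset.sum_add_distrib, ← Finset.sum_mul, ← Finset.mul_sum] at hsum
    -- The summands of a, b, c supply exactly the terms split off in `expand`; what remains is `T ∅`
    -- times the three-point relation over R.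
    refine mul_right_cancel₀ (hT R) ?_
    rw [Finset.sum_insert (by simp [hab, hac, ha]), Finset.sum_insert (by simp [hbc, hb]),
      Finset.sum_insert hc, Finset.erase_insert (by simp [hab, hac, ha]),
      Finset.erase_insert_of_ne hab, Finset.erase_insert (by simp [hbc, hb]),
      Finset.erase_insert_of_ne hac, Finset.erase_insert_of_ne hbc, Finset.erase_insert hc,
      Finset.prod_insert (by simp [hbc, hb]), Finset.prod_insert hc,
      Finset.prod_insert (by simp [hac, ha]), Finset.prod_insert hc,
      Finset.prod_insert (by simp [hab, ha]), Finset.prod_insert hb]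
    linear_combination hsum - T ∅ * e3 + w a b * w a c * T (insert b (insert c R)) * ea +
      w b a * w b c * T (insert a (insert c R)) * eb +
      w c a * w c b * T (insert a (insert b R)) * ec

end Algebra

/-! ### Partial fractions of ∏ (1 + a_i z) / (1 - a_i z) -/

section PartialFractions

open Polynomial in
/-- Lagrange interpolation of `∏ (1 + a_i z) - (-1) ^ N ∏ (1 - a_i z)`. -/
theorem prod_one_add_sub_prod_one_sub {L ι : Type*} [Field L] [DecidableEq ι] {S : Finset ι}
    {a : ι → L} (ha : ∀ i ∈ S, a i ≠ 0) (hinj : Set.InjOn a S) :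
    ∏ i ∈ S, (1 + C (a i) * X) - (-1) ^ S.card * ∏ i ∈ S, (1 - C (a i) * X) =
      ∑ i ∈ S, C (2 * ∏ j ∈ S.erase i, (a i + a j) / (a i - a j)) *
        ∏ j ∈ S.erase i, (1 - C (a j) * X) := by
  rcases S.eq_empty_or_nonempty with rfl | hne
  · simp
  set v : ι → L := fun i => (a i)⁻¹ with hv
  have hvinj : Set.InjOn v S := fun i hi j hj h => hinj hi hj (inv_injective h)
  have hC : ∀ i ∈ S, (C (a i) * C (v i) : L[X]) = 1 := fun i hi => by
    rw [← C_mul, hv]; simp [ha i hi]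
  have hP : ∏ i ∈ S, (1 + C (a i) * X) =
      (∏ i ∈ S, C (a i)) * Lagrange.nodal S (fun i => -v i) := by
    rw [Lagrange.nodal_eq, ← Finset.prod_mul_distrib]
    refine Finset.prod_congr rfl fun i hi => ?_
    rw [C_neg]
    linear_combination -(hC i hi)
  have hQ : (-1) ^ S.card * ∏ i ∈ S, (1 - C (a i) * X) =
      (∏ i ∈ S, C (a i)) * Lagrange.nodal S v := by
    rw [Lagrange.nodal_eq, ← Finset.prod_mul_distrib, ← Finset.prod_const,
      ← Finset.prod_mul_distrib]
    refine Finset.prod_congr rfl fun i hi => ?_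
    linear_combination hC i hi
  -- The sign (-1) ^ |S| leaves a difference of two monic polynomials of degree |S|. The degree
  -- drops, so interpolation at the |S| nodes 1 / a_i is exact.
  have hdeg : (Lagrange.nodal S (fun i => -v i) - Lagrange.nodal S v).degree < S.card := by
    rw [← Lagrange.degree_nodal (s := S) (v := fun i => -v i)]
    refine degree_sub_lt_left ?_ Lagrange.nodal_ne_zero ?_
    · rw [Lagrange.degree_nodal, Lagrange.degree_nodal]
    · rw [Lagrange.nodal_monic.leadingCoeff, Lagrange.nodal_monic.leadingCoeff]
  have hint := Lagrange.eq_interpolate_of_eval_eq (r := fun i => ∏ j ∈ S, (v i + v j)) hvinj hdeg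
    (fun i hi => by
      rw [eval_sub, Lagrange.eval_nodal, Lagrange.eval_nodal_at_node hi]
      simp)
  rw [hP, hQ, ← mul_sub, hint, Lagrange.interpolate_apply, Finset.mul_sum]
  refine Finset.sum_congr rfl fun i hi => ?_
  rw [← Finset.mul_prod_erase S _ hi, ← Finset.mul_prod_erase S (fun j => v i + v j) hi,
    Lagrange.basis, C_mul, C_mul, map_prod, map_prod]
  have h2 : (C (a i) * C (v i + v i) : L[X]) = C 2 := by
    rw [C_add, mul_add, hC i hi, ← C_1, ← C_add]; norm_num
  rw [← h2]
  have hprod : (∏ j ∈ S.erase i, C (a j)) * (∏ j ∈ S.erase i, C (v i + v j)) *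
      ∏ j ∈ S.erase i, Lagrange.basisDivisor (v i) (v j) =
      (∏ j ∈ S.erase i, C ((a i + a j) / (a i - a j))) *
        ∏ j ∈ S.erase i, (1 - C (a j) * X) := by
    simp only [← Finset.prod_mul_distrib]
    refine Finset.prod_congr rfl fun j hj => ?_
    obtain ⟨hji, hj⟩ := Finset.mem_erase.mp hj
    have hij : a i - a j ≠ 0 := sub_ne_zero.mpr fun h => hji (hinj hj hi h.symm)
    have hvv : (v i + v j) * (v i - v j)⁻¹ = -((a i + a j) / (a i - a j)) := by
      have h1 : v i - v j = -((a i - a j) / (a i * a j)) := by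
        simp only [hv]; field_simp [ha i hi, ha j hj]; ring
      have h2 : v i + v j = (a i + a j) / (a i * a j) := by
        simp only [hv]; field_simp [ha i hi, ha j hj]; ring
      rw [h1, h2, inv_neg, inv_div]
      field_simp [ha i hi, ha j hj]
    have hvC : (C (v i + v j) * C (v i - v j)⁻¹ : L[X]) = -C ((a i + a j) / (a i - a j)) := by
      rw [← C_mul, hvv, C_neg]
    rw [Lagrange.basisDivisor]
    linear_combination (C (a j) * X - C (a j) * C (v j)) * hvC +
      C ((a i + a j) / (a i - a j)) * hC j hj
  linear_combination (C (a i) * C (v i + v i)) * hprod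

/-- Dividing the interpolation identity by ∏ (1 - a_i z) gives the partial fractions of H, and each
1 / (1 - a_i z) is a geometric series. The constant (-1) ^ |S| is seen only at k = 0. -/
theorem coeff_of_mul_prod_one_sub {L ι : Type*} [Field L] [DecidableEq ι] {S : Finset ι}
    {a : ι → L} (ha : ∀ i ∈ S, a i ≠ 0) (hinj : Set.InjOn a S) {H : PowerSeries L}
    (hH : H * ∏ i ∈ S, (1 - PowerSeries.C (a i) * PowerSeries.X) =
      ∏ i ∈ S, (1 + PowerSeries.C (a i) * PowerSeries.X)) (k : ℕ) :
    PowerSeries.coeff k H = (if k = 0 then (-1) ^ S.card else 0) +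
      ∑ i ∈ S, 2 * (∏ j ∈ S.erase i, (a i + a j) / (a i - a j)) * a i ^ k := by
  have hpoly := congrArg (fun p : Polynomial L => (p : PowerSeries L))
    (prod_one_add_sub_prod_one_sub ha hinj)
  simp only [← Polynomial.coeToPowerSeries.ringHom_apply, map_sub, map_mul, map_prod, map_sum,
    map_add, map_one, map_pow, map_neg] at hpoly
  simp only [Polynomial.coeToPowerSeries.ringHom_apply, Polynomial.coe_C, Polynomial.coe_X]
    at hpoly
  have hgeo : ∀ i, PowerSeries.mk (fun n => a i ^ n) *
      (1 - PowerSeries.C (a i) * PowerSeries.X) = 1 := by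
    intro i
    ext n
    rw [mul_sub, mul_one, mul_left_comm, map_sub, PowerSeries.coeff_C_mul]
    cases n with
    | zero => simp
    | succ n =>
      rw [PowerSeries.coeff_succ_mul_X]
      simp [pow_succ', PowerSeries.coeff_one]
  have hne : ∏ i ∈ S, (1 - PowerSeries.C (a i) * PowerSeries.X) ≠ 0 := by
    refine Finset.prod_ne_zero_iff.mpr fun i _ h => ?_
    have := hgeo i
    rw [h, mul_zero] at this
    exact zero_ne_one this
  have hR : H = PowerSeries.C ((-1) ^ S.card) +
      ∑ i ∈ S, PowerSeries.C (2 * ∏ j ∈ S.erase i, (a i + a j) / (a i - a j)) *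
        PowerSeries.mk (fun n => a i ^ n) := by
    refine mul_right_cancel₀ hne ?_
    rw [hH, add_mul, Finset.sum_mul]
    have hterm : ∀ i ∈ S, PowerSeries.C (2 * ∏ j ∈ S.erase i, (a i + a j) / (a i - a j)) *
        PowerSeries.mk (fun n => a i ^ n) * ∏ i ∈ S, (1 - PowerSeries.C (a i) * PowerSeries.X) =
        PowerSeries.C (2 * ∏ j ∈ S.erase i, (a i + a j) / (a i - a j)) *
          ∏ j ∈ S.erase i, (1 - PowerSeries.C (a j) * PowerSeries.X) := by
      intro i hi
      rw [← Finset.mul_prod_erase S _ hi, mul_assoc, ← mul_assoc (PowerSeries.mk _), hgeo,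
        one_mul]
    rw [Finset.sum_congr rfl hterm]
    simp only [map_pow, map_neg, map_one, map_mul, map_prod] at hpoly ⊢
    linear_combination hpoly
  rw [hR, map_add, map_sum, PowerSeries.coeff_C]
  congr 1
  exact Finset.sum_congr rfl fun i _ => by rw [PowerSeries.coeff_C_mul, PowerSeries.coeff_mk]

end PartialFractions

/-! ### Recognizing the product from its logarithmic derivative -/

section Exponential

/-- The series `∑ 2 a ^ (2n+1) z ^ (2n) = 2 a / (1 - a ^ 2 z ^ 2)`, the logarithmic derivative of
`(1 + a z) / (1 - a z)`. -/
noncomputable def logDerivFactor {M : Type*} [CommRing M] (a : M) : PowerSeries M :=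
  PowerSeries.mk fun m => if Even m then 2 * a ^ (m + 1) else 0

theorem logDerivFactor_mul {M : Type*} [CommRing M] (a : M) :
    logDerivFactor a * ((1 - PowerSeries.C a * PowerSeries.X) *
      (1 + PowerSeries.C a * PowerSeries.X)) = PowerSeries.C (2 * a) := by
  have : (1 - PowerSeries.C a * PowerSeries.X) * (1 + PowerSeries.C a * PowerSeries.X) =
      1 - PowerSeries.C (a ^ 2) * PowerSeries.X ^ 2 := by
    rw [map_pow]; ring
  rw [this]
  ext n
  rw [mul_sub, mul_one, mul_left_comm, map_sub, PowerSeries.coeff_C_mul,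
    PowerSeries.coeff_mul_X_pow', PowerSeries.coeff_C]
  rcases n with _ | _ | n
  · simp [logDerivFactor]
  · simp [logDerivFactor]
  · simp only [logDerivFactor, PowerSeries.coeff_mk]
    have he : Even (n + 1 + 1) ↔ Even n := by grind
    by_cases h : Even n <;> simp [he, h]
    ring

/-- A series over a torsion-free ring is determined by its derivative and constant term. Dividing H
by one factor (1 + a z) / (1 - a z) removes one summand of the logarithmic derivative, which drives
the induction. -/
theorem mul_prod_one_sub_of_derivative {M ι : Type*} [CommRing M] [Nontrivial M] [NoZeroDivisors M]
    [IsAddTorsionFree M] [DecidableEq ι] (S : Finset ι) (a : ι → M) (H : PowerSeries M)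
    (h0 : PowerSeries.constantCoeff H = 1)
    (hd : PowerSeries.derivative M H = H * ∑ i ∈ S, logDerivFactor (a i)) :
    H * ∏ i ∈ S, (1 - PowerSeries.C (a i) * PowerSeries.X) =
      ∏ i ∈ S, (1 + PowerSeries.C (a i) * PowerSeries.X) := by
  induction S using Finset.induction_on generalizing H with
  | empty =>
    simp only [Finset.prod_empty, mul_one]
    refine PowerSeries.derivative.ext ?_ (by simpa using h0)
    simpa using hd
  | insert b S hb ih =>
    rw [Finset.sum_insert hb] at hd
    set p : PowerSeries M := 1 + PowerSeries.C (a b) * PowerSeries.X with hp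
    set q : PowerSeries M := 1 - PowerSeries.C (a b) * PowerSeries.X with hq
    have hp0 : p ≠ 0 := fun h => by
      have := congrArg PowerSeries.constantCoeff h
      simp [hp] at this
    obtain ⟨u, hu⟩ : ∃ u, p * u = 1 :=
      ⟨_, PowerSeries.mul_invOfUnit p 1 (by simp [hp])⟩
    have hdp : PowerSeries.derivative M p = PowerSeries.C (a b) := by
      simp [hp, PowerSeries.derivative_X]
    have hdq : PowerSeries.derivative M q = -PowerSeries.C (a b) := by
      simp [hq, PowerSeries.derivative_X]
    have hdu : p * PowerSeries.derivative M u + u * PowerSeries.C (a b) = 0 := by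
      have := congrArg (PowerSeries.derivative M) hu
      rwa [Derivation.leibniz, smul_eq_mul, smul_eq_mul, hdp, Derivation.map_one_eq_zero] at this
    have hlog := logDerivFactor_mul (a b)
    rw [← hp, ← hq, map_mul] at hlog
    have h2 : q + p = PowerSeries.C 2 := by
      rw [hp, hq, show (2 : M) = 1 + 1 by norm_num, map_add, map_one]; ring
    -- Since u = 1 / p, the factor q u is the inverse of (1 + a_b z) / (1 - a_b z).
    have hG := ih (H * (q * u)) ?_ ?_
    · rw [Finset.prod_insert hb, Finset.prod_insert hb, ← hp, ← hq, ← hG]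
      linear_combination (-H * q * ∏ i ∈ S, (1 - PowerSeries.C (a i) * PowerSeries.X)) * hu
    · have hu0 : PowerSeries.constantCoeff u = 1 := by
        have := congrArg PowerSeries.constantCoeff hu
        simpa [hp] using this
      simp [h0, hu0, hq]
    · refine mul_left_cancel₀ (pow_ne_zero 2 hp0) ?_
      simp only [Derivation.leibniz, smul_eq_mul, hd, hdq]
      linear_combination (H * q * p) * hdu + H * u * p * hlog - H * p * u * PowerSeries.C (a b) * h2

end Exponential

/-! ### Substitutions and evaluation of a series at λ⁻¹ = z -/

section Substitution

open MvPowerSeries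
open scoped MvPowerSeries.WithPiTopology

theorem hasSubst_sumElim {K σ₁ σ₂ τ : Type*} [CommRing K] {a : σ₁ → MvPowerSeries τ K}
    {b : σ₂ → MvPowerSeries τ K} (ha : HasSubst a) (hb : HasSubst b) :
    HasSubst (Sum.elim a b) where
  const_coeff := by rintro (s | s); exacts [ha.const_coeff s, hb.const_coeff s]
  coeff_zero d := by
    refine (((ha.coeff_zero d).image Sum.inl).union ((hb.coeff_zero d).image Sum.inr)).subset ?_
    rintro (s | s) hs
    · exact Or.inl ⟨s, hs, rfl⟩
    · exact Or.inr ⟨s, hs, rfl⟩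

theorem hasSubst_optionElim {K σ τ : Type*} [CommRing K] {a : σ → MvPowerSeries τ K}
    {z : MvPowerSeries τ K} (ha : HasSubst a) (hz : constantCoeff z = 0) :
    HasSubst (fun o : Option σ => o.elim z a) where
  const_coeff := by
    rintro (_ | s)
    · simp [hz]
    · exact ha.const_coeff s
  coeff_zero d := by
    refine (((ha.coeff_zero d).image Option.some).union (Set.finite_singleton none)).subset ?_
    rintro (_ | s) hs
    · exact Or.inr rfl
    · exact Or.inl ⟨s, hs, rfl⟩

theorem optionEquivLeft_rename_some {K σ : Type*} [CommRing K] (c : MvPowerSeries σ K) :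
    optionEquivLeft σ K (rename (Function.Embedding.some : σ ↪ Option σ) c) =
      PowerSeries.C c := by
  classical
  ext n x
  rw [coeff_coeff_optionEquivLeft, PowerSeries.coeff_C]
  split_ifs with h
  · subst h
    have : x.optionElim 0 = Finsupp.embDomain Function.Embedding.some x := by
      ext o
      rcases o with _ | s
      · rw [Finsupp.optionElim_apply_none, Finsupp.embDomain_of_notMem_range]
        simp
      · rw [Finsupp.optionElim_apply_some]
        exact (Finsupp.embDomain_apply_self Function.Embedding.some x s).symm
    rw [this, coeff_embDomain_rename]
  · rw [coeff_rename_eq_zero, coeff_zero]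
    rintro ⟨y, hy⟩
    have := DFunLike.congr_fun hy none
    rw [Finsupp.optionElim_apply_none, Finsupp.mapDomain_of_notMem_range _ _ (by simp)] at this
    exact h this.symm

/-- A power series in the variables `none` and `some s` is evaluated by expanding it in powers of
the variable `none`. -/
theorem hasSum_subst_optionElim {K σ τ : Type*} [CommRing K] [UniformSpace K]
    [DiscreteUniformity K] {a : σ → MvPowerSeries τ K} {z : MvPowerSeries τ K} (ha : HasSubst a)
    (hz : constantCoeff z = 0) (G : MvPowerSeries (Option σ) K) :
    HasSum (fun k => (PowerSeries.coeff k (optionEquivLeft σ K G)).subst a * z ^ k)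
      (G.subst (fun o : Option σ => o.elim z a)) := by
  have hsub := hasSubst_optionElim ha hz
  have h1 : HasSum (fun k => rename (Function.Embedding.some : σ ↪ Option σ)
      (PowerSeries.coeff k (optionEquivLeft σ K G)) * X none ^ k) G := by
    rw [WithPiTopology.hasSum_iff_hasSum_coeff]
    intro d
    have hd : ∀ p : MvPowerSeries (Option σ) K, coeff d p =
        coeff d.some (PowerSeries.coeff (d none) (optionEquivLeft σ K p)) := fun p => by
      rw [coeff_coeff_optionEquivLeft, Finsupp.optionElim_some]
    simp only [hd, map_mul, optionEquivLeft_rename_some, map_pow, optionEquivLeft_X_none,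
      PowerSeries.coeff_C_mul, PowerSeries.coeff_X_pow]
    convert hasSum_ite_eq (d none)
      (coeff d.some (PowerSeries.coeff (d none) (optionEquivLeft σ K G))) using 2 with k
    by_cases h : d none = k
    · subst h; simp
    · simp [h, Ne.symm h]
  have h2 := h1.map (substAlgHom (R := K) hsub) (by
    rw [coe_substAlgHom]; exact continuous_subst hsub)
  rw [substAlgHom_apply] at h2
  convert h2 using 2 with k
  rw [Function.comp_apply, map_mul, map_pow, substAlgHom_X, substAlgHom_apply, rename_eq_subst,
    subst_comp_subst_apply (HasSubst.X_comp _) hsub]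
  congr 2
  funext s
  simp [subst_X hsub]

variable {K : Type*} [Field K]

theorem bracket_zero {σ : Type*} (n : ℕ) : bracket (0 : MvPowerSeries σ K) n = 0 := by
  simp [bracket]

theorem subst_bracket {σ τ : Type*} {h : σ → MvPowerSeries τ K} (hh : HasSubst h)
    (z : MvPowerSeries σ K) (n : ℕ) : (bracket z n).subst h = bracket (z.subst h) n := by
  rw [bracket, bracket, subst_mul hh, subst_pow hh, subst_C]

/-- The arguments `x + 2 ∑_{i ∈ S} [α_i]ₒ`, for parameters indexed by an arbitrary type. -/
noncomputable def argShift (K : Type*) [Field K] {ι : Type*} (S : Finset ι) (n : ℕ) :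
    MvPowerSeries (ℕ ⊕ ι) K :=
  X (Sum.inl n) + 2 * ∑ i ∈ S, bracket (X (Sum.inr i)) n

theorem hasSubst_argShift (K : Type*) [Field K] {ι : Type*} (S : Finset ι) :
    HasSubst (argShift K S) := by
  have h1 : HasSubst (∑ i ∈ S, fun n => bracket (X (Sum.inr i) : MvPowerSeries (ℕ ⊕ ι) K) n) :=
    Ideal.sum_mem hasSubstIdeal fun i _ => hasSubst_bracket (constantCoeff_X (Sum.inr i))
  have h := (hasSubst_X (K := K) (f := fun n => (Sum.inl n : ℕ ⊕ ι))
    Sum.inl_injective).add (h1.smul 2)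
  convert h using 1
  funext n
  simp [argShift]

theorem subst_argShift {ι τ : Type*} {h : ℕ ⊕ ι → MvPowerSeries τ K} (hh : HasSubst h)
    (S : Finset ι) (n : ℕ) :
    (argShift K S n).subst h = h (Sum.inl n) + 2 * ∑ i ∈ S, bracket (h (Sum.inr i)) n := by
  rw [argShift, ← substAlgHom_apply hh]
  simp only [map_add, map_mul, map_sum, map_ofNat, substAlgHom_apply, subst_bracket hh,
    subst_X hh]

theorem argShift_empty {ι : Type*} (n : ℕ) :
    argShift K (∅ : Finset ι) n = X (Sum.inl n) := by simp [argShift]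

/-- The substitution `t = x + 2 ∑_{i ∈ S} [α_i]ₒ`, `t' = x`. -/
noncomputable def argTimes (K : Type*) [Field K] {ι : Type*} (S : Finset ι) :
    ℕ ⊕ ℕ → MvPowerSeries (ℕ ⊕ ι) K :=
  Sum.elim (argShift K S) (fun n => X (Sum.inl n))

theorem hasSubst_argTimes (K : Type*) [Field K] {ι : Type*} (S : Finset ι) :
    HasSubst (argTimes K S) :=
  hasSubst_sumElim (hasSubst_argShift K S) (hasSubst_X Sum.inl_injective)

theorem subst_argLeft_mul_argRight {ι : Type*} {S : Finset ι} {z : MvPowerSeries (ℕ ⊕ ι) K}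
    (hz : constantCoeff z = 0) (τ : MvPowerSeries ℕ K) :
    (τ.subst (argLeft K) * τ.subst (argRight K)).subst
        (fun o : Option (ℕ ⊕ ℕ) => o.elim z (argTimes K S)) =
      τ.subst (fun n => argShift K S n - 2 * bracket z n) *
        τ.subst (fun n => (X (Sum.inl n) : MvPowerSeries (ℕ ⊕ ι) K) + 2 * bracket z n) := by
  have hsub := hasSubst_optionElim (hasSubst_argTimes K S) hz
  rw [subst_mul hsub, subst_comp_subst_apply (hasSubst_argLeft K) hsub,
    subst_comp_subst_apply (hasSubst_argRight K) hsub]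
  congr 2 <;> funext n
  · rw [argLeft, ← substAlgHom_apply hsub]
    simp only [map_sub, map_mul, map_ofNat, substAlgHom_apply, subst_bracket hsub, subst_X hsub]
    rfl
  · rw [argRight, ← substAlgHom_apply hsub]
    simp only [map_add, map_mul, map_ofNat, substAlgHom_apply, subst_bracket hsub, subst_X hsub]
    rfl

/-- The value at λ⁻¹ = 0, to be paired with the constant partial fraction. -/
theorem subst_argLeft_mul_argRight_zero {ι : Type*} (S : Finset ι) (τ : MvPowerSeries ℕ K) :
    (τ.subst (argLeft K) * τ.subst (argRight K)).subst
        (fun o : Option (ℕ ⊕ ℕ) => o.elim 0 (argTimes K S)) =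
      τ.subst (argShift K S) * τ.subst (argShift K (∅ : Finset ι)) := by
  rw [subst_argLeft_mul_argRight (map_zero _)]
  congr 2 <;> funext n <;> simp [bracket_zero, argShift_empty]

/-- At λ⁻¹ = α_i the shift by -2[α_i]ₒ cancels the point i in t, and the shift by 2[α_i]ₒ creates it
in t'. -/
theorem subst_argLeft_mul_argRight_X {ι : Type*} [DecidableEq ι] {S : Finset ι} {i : ι}
    (hi : i ∈ S) (τ : MvPowerSeries ℕ K) :
    (τ.subst (argLeft K) * τ.subst (argRight K)).subst
        (fun o : Option (ℕ ⊕ ℕ) => o.elim (X (Sum.inr i)) (argTimes K S)) =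
      τ.subst (argShift K (S.erase i)) * τ.subst (argShift K {i}) := by
  rw [subst_argLeft_mul_argRight (constantCoeff_X _)]
  congr 2 <;> funext n
  · rw [argShift, argShift, ← Finset.add_sum_erase S _ hi]
    ring
  · simp [argShift]

end Substitution

/-! ### The formal integral and the exponential as series -/

section Residue

open MvPowerSeries
open scoped MvPowerSeries.WithPiTopology

variable {K : Type*} [Field K] [CharZero K]

/-- Presents the coefficientwise finite sum as a convergent series, to which continuous
substitutions apply termwise. -/
theorem hasSum_residue [TopologicalSpace K] (b : PowerSeries (TwoTimes K)) :
    HasSum (fun k => PowerSeries.coeff k (expXi K) * PowerSeries.coeff k b)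
      (residue (expXi K) b) := by
  rw [WithPiTopology.hasSum_iff_hasSum_coeff]
  intro d
  have hf := finite_support_residue b d
  have : coeff d (residue (expXi K) b) = ∑ k ∈ hf.toFinset,
      coeff d (PowerSeries.coeff k (expXi K) * PowerSeries.coeff k b) :=
    finsum_eq_sum _ hf
  rw [this]
  exact hasSum_sum_of_ne_finset_zero fun k hk => by simpa using hk

/-- With the exponential series taken over the coefficient ring of ξ̃, the chain rule for d/dλ
becomes applicable. -/
theorem expXi_eq : expXi K = (PowerSeries.exp (TwoTimes K)).subst (xi K) := by
  have h1 : PowerSeries.exp (TwoTimes K) =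
      (PowerSeries.exp K).subst (PowerSeries.X : PowerSeries (TwoTimes K)) := by
    rw [← PowerSeries.map_algebraMap_eq_subst_X, PowerSeries.map_exp]
  rw [h1, PowerSeries.subst_comp_subst_apply PowerSeries.HasSubst.X' (hasSubst_xi K),
    PowerSeries.subst_X (hasSubst_xi K), expXi]

theorem constantCoeff_expXi : PowerSeries.constantCoeff (expXi K) = 1 := by
  have h0 : PowerSeries.constantCoeff (xi K) = 0 := by
    rw [← PowerSeries.coeff_zero_eq_constantCoeff_apply]; simp [xi]
  have h1 := PowerSeries.constantCoeff_subst_eq_zero (a := xi K)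
    h0 (PowerSeries.exp (TwoTimes K) - 1) (by simp)
  rw [PowerSeries.subst_sub (hasSubst_xi K), ← expXi_eq,
    ← PowerSeries.coe_substAlgHom (hasSubst_xi K), map_one, map_sub, sub_eq_zero, map_one] at h1
  exact h1

theorem derivative_expXi : PowerSeries.derivative (TwoTimes K) (expXi K) =
    expXi K * PowerSeries.derivative (TwoTimes K) (xi K) := by
  rw [expXi_eq, PowerSeries.derivative_subst (hasSubst_xi K), PowerSeries.derivative_exp]

end Residue

/-! ### The hierarchy at t = x + 2 ∑ [α_i]ₒ, t' = x -/

section Specialization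

open MvPowerSeries
open scoped MvPowerSeries.WithPiTopology

variable {K : Type*} [Field K] {ι : Type*}

/-- The image of `τ(x + 2 ∑_{i ∈ S} [α_i]ₒ)` in the field of fractions. -/
noncomputable def shiftTau (τ : MvPowerSeries ℕ K) (S : Finset ι) :
    FractionRing (MvPowerSeries (ℕ ⊕ ι) K) :=
  algebraMap (MvPowerSeries (ℕ ⊕ ι) K) _ (τ.subst (argShift K S))

/-- The parameter `α_i` in the field of fractions. -/
noncomputable def param (K : Type*) [Field K] {ι : Type*} (i : ι) :
    FractionRing (MvPowerSeries (ℕ ⊕ ι) K) :=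
  algebraMap (MvPowerSeries (ℕ ⊕ ι) K) _ (X (Sum.inr i))

/-- The quotient `(α_i + α_j) / (α_i - α_j)`. -/
noncomputable def ratioParam (K : Type*) [Field K] {ι : Type*} (i j : ι) :
    FractionRing (MvPowerSeries (ℕ ⊕ ι) K) :=
  (param K i + param K j) / (param K i - param K j)

theorem X_injective {σ : Type*} : Function.Injective (X : σ → MvPowerSeries σ K) := by
  intro i j h
  classical
  have := congrArg (coeff (Finsupp.single i 1)) h
  rw [coeff_X, coeff_X, if_pos rfl] at this
  by_contra hij
  rw [if_neg (fun h' => hij (Finsupp.single_left_injective one_ne_zero h'))] at this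
  exact one_ne_zero this

theorem param_injective : Function.Injective (param K : ι → _) :=
  (FaithfulSMul.algebraMap_injective _ _).comp (X_injective.comp Sum.inr_injective)

theorem param_ne_zero (i : ι) : param K i ≠ 0 := by
  intro h
  have h2 : (X (Sum.inr i) : MvPowerSeries (ℕ ⊕ ι) K) = 0 :=
    (FaithfulSMul.algebraMap_injective _ (FractionRing (MvPowerSeries (ℕ ⊕ ι) K)))
      (h.trans (map_zero _).symm)
  have := congrArg (coeff (Finsupp.single (Sum.inr i) 1)) h2
  rw [coeff_index_single_self_X, coeff_zero] at this
  exact one_ne_zero this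

theorem ratioParam_antisymm (i j : ι) : ratioParam K i j = -ratioParam K j i := by
  rw [ratioParam, ratioParam, ← neg_sub (param K i) (param K j), div_neg, neg_neg, add_comm]

variable [CharZero K]

/-- Differentiation in λ cancels the denominators 2n+1 in [α]ₒ. -/
theorem derivative_map_xi (S : Finset ι) :
    PowerSeries.derivative _ (PowerSeries.map
        (substAlgHom (R := K) (hasSubst_argTimes K S) : TwoTimes K →+* _) (xi K)) =
      ∑ i ∈ S, logDerivFactor (X (Sum.inr i) : MvPowerSeries (ℕ ⊕ ι) K) := by
  ext1 m
  rw [PowerSeries.coeff_derivative, PowerSeries.coeff_map, map_sum, xi, PowerSeries.coeff_mk]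
  simp only [logDerivFactor, PowerSeries.coeff_mk]
  by_cases hm : Even m
  · obtain ⟨n, hn⟩ := hm
    obtain rfl : m = 2 * n := by omega
    have h1 : Odd (2 * n + 1) := ⟨n, rfl⟩
    have h2 : (2 * n + 1) / 2 = n := by omega
    have h3 : Even (2 * n) := even_two_mul n
    rw [if_pos h1, h2]
    simp only [h3, if_true, RingHom.coe_coe, map_sub, substAlgHom_X, argTimes, Sum.elim_inl,
      Sum.elim_inr, argShift, add_sub_cancel_left]
    rw [Finset.mul_sum, Finset.sum_mul]
    refine Finset.sum_congr rfl fun i _ => ?_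
    have h4 : (C (1 / (2 * (n : K) + 1)) * (((2 * n : ℕ) : MvPowerSeries (ℕ ⊕ ι) K) + 1)) = 1 := by
      have h5 : (2 * (n : K) + 1) ≠ 0 := by exact_mod_cast Nat.succ_ne_zero (2 * n)
      have h6 : ((2 * n : ℕ) : MvPowerSeries (ℕ ⊕ ι) K) + 1 = C (2 * (n : K) + 1) := by
        rw [map_add, map_mul, map_natCast, map_ofNat, map_one]; push_cast; rfl
      rw [h6, ← map_mul, one_div_mul_cancel h5, map_one]
    rw [bracket]
    linear_combination (2 * X (Sum.inr i) ^ (2 * n + 1)) * h4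
  · have h1 : ¬ Odd (m + 1) := by
      rwa [Nat.odd_add_one, Nat.not_odd_iff_even]
    simp only [hm, h1, if_false, map_zero, zero_mul, Finset.sum_const_zero]

theorem map_expXi_mul_prod [DecidableEq ι] (S : Finset ι) :
    PowerSeries.map (substAlgHom (R := K) (hasSubst_argTimes K S) : TwoTimes K →+* _) (expXi K) *
        ∏ i ∈ S, (1 - PowerSeries.C (X (Sum.inr i)) * PowerSeries.X) =
      ∏ i ∈ S, (1 + PowerSeries.C (X (Sum.inr i) : MvPowerSeries (ℕ ⊕ ι) K) *
        PowerSeries.X) := by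
  have : IsAddTorsionFree (MvPowerSeries (ℕ ⊕ ι) K) := .of_module_rat _
  refine mul_prod_one_sub_of_derivative S (fun i => (X (Sum.inr i) : MvPowerSeries (ℕ ⊕ ι) K)) _
    ?_ ?_
  · rw [← PowerSeries.coeff_zero_eq_constantCoeff_apply, PowerSeries.coeff_map,
      PowerSeries.coeff_zero_eq_constantCoeff_apply, constantCoeff_expXi, map_one]
  · rw [← derivative_map_xi]
    have hmap : ∀ f : PowerSeries (TwoTimes K), PowerSeries.derivative _ (PowerSeries.map
        (substAlgHom (R := K) (hasSubst_argTimes K S) :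
          TwoTimes K →+* MvPowerSeries (ℕ ⊕ ι) K) f) =
        PowerSeries.map (substAlgHom (R := K) (hasSubst_argTimes K S) : TwoTimes K →+* _)
          (PowerSeries.derivative _ f) := by
      intro f
      ext1 n
      simp only [PowerSeries.coeff_derivative, PowerSeries.coeff_map, map_mul, map_add,
        map_natCast, map_one]
    rw [hmap, hmap, derivative_expXi, map_mul]

/-- The fraction field is needed because the partial fractions divide by α_i - α_j; odd |S| makes
the constant term -1. -/
theorem algebraMap_coeff_expXi [DecidableEq ι] {S : Finset ι} (hS : Odd S.card) (k : ℕ) :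
    algebraMap (MvPowerSeries (ℕ ⊕ ι) K) (FractionRing (MvPowerSeries (ℕ ⊕ ι) K))
        ((PowerSeries.coeff k (expXi K)).subst (argTimes K S)) =
      (if k = 0 then -1 else 0) +
        ∑ i ∈ S, 2 * (∏ j ∈ S.erase i, ratioParam K i j) * param K i ^ k := by
  have h := congrArg (PowerSeries.map (algebraMap (MvPowerSeries (ℕ ⊕ ι) K)
    (FractionRing (MvPowerSeries (ℕ ⊕ ι) K)))) (map_expXi_mul_prod (K := K) S)
  simp only [map_mul, map_prod, map_sub, map_add, map_one, PowerSeries.map_C,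
    PowerSeries.map_X] at h
  have := coeff_of_mul_prod_one_sub (a := param K) (fun i _ => param_ne_zero i)
    param_injective.injOn h k
  rw [PowerSeries.coeff_map, PowerSeries.coeff_map, hS.neg_one_pow] at this
  simpa [ratioParam] using this

/-- The formal integral at `t = x + 2 ∑_{i ∈ S} [α_i]ₒ`, `t' = x` is a sum of residues. -/
theorem algebraMap_subst_residue [DecidableEq ι] {S : Finset ι} (hS : Odd S.card)
    (τ : MvPowerSeries ℕ K) :
    algebraMap (MvPowerSeries (ℕ ⊕ ι) K) (FractionRing (MvPowerSeries (ℕ ⊕ ι) K))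
        ((residue (expXi K) (tauTau τ)).subst (argTimes K S)) =
      -(shiftTau τ S * shiftTau τ ∅) + ∑ i ∈ S, 2 * (∏ j ∈ S.erase i, ratioParam K i j) *
        (shiftTau τ (S.erase i) * shiftTau τ {i}) := by
  classical
  let _ : UniformSpace K := ⊥
  have : DiscreteUniformity K := ⟨rfl⟩
  set φ := substAlgHom (R := K) (hasSubst_argTimes K S) with hφ
  set c : ι → FractionRing (MvPowerSeries (ℕ ⊕ ι) K) :=
    fun i => 2 * ∏ j ∈ S.erase i, ratioParam K i j with hc
  -- A common denominator D of the coefficients 2 c_i moves the infinite sums from the fraction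
  -- field to the power series ring, where convergence makes sense.
  obtain ⟨D, hD⟩ := IsLocalization.exist_integer_multiples_of_finset
    (nonZeroDivisors (MvPowerSeries (ℕ ⊕ ι) K)) (S.image c)
  have hD' : ∀ i ∈ S, ∃ C, algebraMap (MvPowerSeries (ℕ ⊕ ι) K) _ C =
      algebraMap (MvPowerSeries (ℕ ⊕ ι) K) _ D * c i := fun i hi => by
    obtain ⟨C, hC⟩ := hD (c i) (Finset.mem_image_of_mem _ hi)
    exact ⟨C, by rw [hC, Algebra.smul_def]⟩
  choose! E hE using hD'
  have hinj : Function.Injective (algebraMap (MvPowerSeries (ℕ ⊕ ι) K)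
    (FractionRing (MvPowerSeries (ℕ ⊕ ι) K))) := FaithfulSMul.algebraMap_injective _ _
  have hcoeff : ∀ k, (D : MvPowerSeries (ℕ ⊕ ι) K) * φ (PowerSeries.coeff k (expXi K)) =
      (if k = 0 then -(D : MvPowerSeries (ℕ ⊕ ι) K) else 0) + ∑ i ∈ S, E i * X (Sum.inr i) ^ k := by
    intro k
    apply hinj
    rw [map_mul, hφ, substAlgHom_apply, algebraMap_coeff_expXi hS, map_add, map_sum, mul_add,
      Finset.mul_sum]
    congr 1
    · split_ifs <;> simp
    · refine Finset.sum_congr rfl fun i hi => ?_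
      rw [map_mul, map_pow, hE i hi, param]
      ring
  have hφc : Continuous φ := by
    rw [hφ, coe_substAlgHom]; exact continuous_subst (hasSubst_argTimes K S)
  have h1 := ((hasSum_residue (tauTau τ)).map φ hφc).mul_left (D : MvPowerSeries (ℕ ⊕ ι) K)
  have h2 : ∀ (z : MvPowerSeries (ℕ ⊕ ι) K), constantCoeff z = 0 → _ := fun z hz =>
    hasSum_subst_optionElim (hasSubst_argTimes K S) hz
      (τ.subst (argLeft K) * τ.subst (argRight K))
  have h3 := ((h2 0 (map_zero _)).mul_left (-D : MvPowerSeries (ℕ ⊕ ι) K)).add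
    (hasSum_sum fun i (_ : i ∈ S) => (h2 (X (Sum.inr i)) (constantCoeff_X _)).mul_left (E i))
  -- Both sides sum the same series: by `hcoeff` the k-th term splits into multiples of b_k z ^ k
  -- for z = 0 (with 0 ^ 0 = 1) and z = α_i.
  have h4 := h3.unique (a₂ := (D : MvPowerSeries (ℕ ⊕ ι) K) * φ (residue (expXi K) (tauTau τ))) <| by
    convert h1 using 2 with k
    symm
    rw [Function.comp_apply, map_mul, ← mul_assoc, hcoeff, add_mul, Finset.sum_mul, hφ,
      substAlgHom_apply]
    congr 1
    · rcases k with _ | k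
      · simp [tauTau]
      · simp
    · exact Finset.sum_congr rfl fun i _ => by rw [tauTau]; ring
  have h5 := congrArg (algebraMap (MvPowerSeries (ℕ ⊕ ι) K)
    (FractionRing (MvPowerSeries (ℕ ⊕ ι) K))) h4
  have hDne : algebraMap (MvPowerSeries (ℕ ⊕ ι) K)
      (FractionRing (MvPowerSeries (ℕ ⊕ ι) K)) D ≠ 0 :=
    fun h => nonZeroDivisors.coe_ne_zero D (hinj (h.trans (map_zero _).symm))
  refine mul_left_cancel₀ hDne ?_
  rw [map_mul] at h5
  rw [← substAlgHom_apply (hasSubst_argTimes K S), ← h5, map_add, map_sum, map_mul, map_neg,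
    subst_argLeft_mul_argRight_zero, map_mul, mul_add, Finset.mul_sum]
  congr 1
  · simp only [shiftTau]; ring
  · refine Finset.sum_congr rfl fun i hi => ?_
    rw [map_mul, hE i hi, subst_argLeft_mul_argRight_X hi, map_mul, shiftTau, shiftTau, mul_assoc]

end Specialization

/-! ### Algebraic independence of the odd power sums -/

section AlgebraicIndependence

open MvPolynomial

variable {K : Type*} [Field K]

/-- The polynomial version of `argTimes`. -/
noncomputable def polyTimes (K : Type*) [Field K] {ι : Type*} (S : Finset ι) :
    ℕ ⊕ ℕ → MvPolynomial (ℕ ⊕ ι) K :=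
  Sum.elim
    (fun n => X (Sum.inl n) + 2 * ∑ i ∈ S, C (1 / (2 * (n : K) + 1)) * X (Sum.inr i) ^ (2 * n + 1))
    (fun n => X (Sum.inl n))

theorem coe_polyTimes {ι : Type*} (S : Finset ι) (s : ℕ ⊕ ℕ) :
    (polyTimes K S s : MvPowerSeries (ℕ ⊕ ι) K) = argTimes K S s := by
  rcases s with n | n
  · have h2 : ((2 : MvPolynomial (ℕ ⊕ ι) K) : MvPowerSeries (ℕ ⊕ ι) K) = 2 :=
      map_ofNat (MvPolynomial.coeToMvPowerSeries.ringHom) 2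
    have hs : ((∑ i ∈ S, C (1 / (2 * (n : K) + 1)) * X (Sum.inr i) ^ (2 * n + 1) :
        MvPolynomial (ℕ ⊕ ι) K) : MvPowerSeries (ℕ ⊕ ι) K) =
        ∑ i ∈ S, bracket (MvPowerSeries.X (Sum.inr i)) n := by
      rw [← MvPolynomial.coeToMvPowerSeries.ringHom_apply, map_sum]
      simp [bracket]
    simp only [polyTimes, argTimes, argShift, Sum.elim_inl]
    rw [MvPolynomial.coe_add, MvPolynomial.coe_mul, hs, h2, MvPolynomial.coe_X]
  · simp [polyTimes, argTimes]

/-- The chain rule for polynomials in infinitely many variables. -/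
theorem exists_derivation_aeval {σ A : Type*} [CommRing A] [Algebra K A] [DecidableEq σ]
    (D : Derivation K A A) (g : σ → A) (p : MvPolynomial σ K) :
    ∃ V₀ : Finset σ, ∀ V, V₀ ⊆ V → D (aeval g p) = ∑ s ∈ V, aeval g (pderiv s p) * D (g s) := by
  induction p using MvPolynomial.induction_on with
  | C a => exact ⟨∅, fun V _ => by simp⟩
  | add p q hp hq =>
    obtain ⟨V₁, h₁⟩ := hp
    obtain ⟨V₂, h₂⟩ := hq
    refine ⟨V₁ ∪ V₂, fun V hV => ?_⟩
    rw [map_add, map_add, h₁ V (Finset.union_subset_left hV), h₂ V (Finset.union_subset_right hV),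
      ← Finset.sum_add_distrib]
    exact Finset.sum_congr rfl fun s _ => by rw [map_add, map_add, add_mul]
  | mul_X p t hp =>
    obtain ⟨V₁, h₁⟩ := hp
    refine ⟨insert t V₁, fun V hV => ?_⟩
    have ht : t ∈ V := hV (Finset.mem_insert_self _ _)
    rw [map_mul, aeval_X, Derivation.leibniz, h₁ V fun s hs => hV (Finset.mem_insert_of_mem hs),
      smul_eq_mul, smul_eq_mul, Finset.mul_sum]
    have hterm : ∀ s ∈ V, aeval g (pderiv s (p * X t)) * D (g s) =
        g t * (aeval g (pderiv s p) * D (g s)) +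
          (if t = s then aeval g p * D (g s) else 0) := by
      intro s _
      rw [Derivation.leibniz, smul_eq_mul, smul_eq_mul, map_add, map_mul, map_mul, aeval_X,
        pderiv_X]
      by_cases h : t = s
      · subst h; simp; ring
      · simp [h]; ring
    rw [Finset.sum_congr rfl hterm, Finset.sum_add_distrib, Finset.sum_ite_eq, if_pos ht, add_comm]

/-- Setting the parameter `α_i` to `0`. -/
noncomputable def dropParam (K : Type*) [Field K] {ι : Type*} [DecidableEq ι] (i : ι) :
    MvPolynomial (ℕ ⊕ ι) K →ₐ[K] MvPolynomial (ℕ ⊕ ι) K :=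
  aeval (fun s => if s = Sum.inr i then 0 else X s)

theorem dropParam_aeval_insert {ι : Type*} [DecidableEq ι] {i : ι} {S : Finset ι} (hi : i ∉ S)
    (p : MvPolynomial (ℕ ⊕ ℕ) K) :
    dropParam K i (aeval (polyTimes K (insert i S)) p) = aeval (polyTimes K S) p := by
  rw [← AlgHom.comp_apply, comp_aeval]
  congr 2
  funext s
  rcases s with n | n
  · simp only [polyTimes, Sum.elim_inl, Finset.sum_insert hi, dropParam, map_add, map_mul, map_sum,
      map_pow, aeval_X, algHom_C, map_ofNat]
    have : ∑ j ∈ S, algebraMap K (MvPolynomial (ℕ ⊕ ι) K) (1 / (2 * (n : K) + 1)) *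
        (if (Sum.inr j : ℕ ⊕ ι) = Sum.inr i then 0 else X (Sum.inr j)) ^ (2 * n + 1) =
        ∑ j ∈ S, C (1 / (2 * (n : K) + 1)) * X (Sum.inr j) ^ (2 * n + 1) := by
      refine Finset.sum_congr rfl fun j hj => ?_
      rw [if_neg (fun h => hi ((Sum.inr_injective h : j = i) ▸ hj))]
      rfl
    rw [this]
    simp
  · simp [polyTimes, dropParam]

variable [CharZero K]

/-- Differentiate the relation for S ∪ {i} in a fresh α_i. As t_{2m+1} has derivative 2 α_i ^ (2m)
and t' has derivative 0, this gives ∑_m 2 α_i ^ (2m) ∂p/∂t_{2m+1} = 0. Terms with m < n vanish by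
induction; dividing by α_i ^ (2n) and setting α_i = 0 isolates the term m = n. -/
theorem aeval_polyTimes_pderiv_inl {p : MvPolynomial (ℕ ⊕ ℕ) K}
    (hp : ∀ S : Finset ℕ, aeval (polyTimes K S) p = 0) (n : ℕ) (S : Finset ℕ) :
    aeval (polyTimes K S) (pderiv (Sum.inl n) p) = 0 := by
  classical
  induction n using Nat.strong_induction_on generalizing S with
  | _ n ih =>
    obtain ⟨i, hi⟩ := Infinite.exists_notMem_finset S
    obtain ⟨V₀, hV₀⟩ := exists_derivation_aeval (pderiv (R := K) (Sum.inr i : ℕ ⊕ ℕ))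
      (polyTimes K (insert i S)) p
    obtain ⟨N, hnN, hN⟩ : ∃ N, n < N ∧ V₀ ⊆ (Finset.range N).disjSum (Finset.range N) := by
      refine ⟨(V₀.sup (Sum.elim id id)) + n + 1, by omega, fun s hs => ?_⟩
      have := Finset.le_sup (f := Sum.elim (id : ℕ → ℕ) id) hs
      rcases s with m | m <;> simp at this ⊢ <;> omega
    have h := hV₀ _ hN
    rw [hp, map_zero, Finset.sum_disjSum] at h
    have hr : ∀ m, pderiv (Sum.inr i) (polyTimes K (insert i S) (Sum.inr m)) = 0 := fun m => by
      simp [polyTimes, pderiv_X]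
    have hl : ∀ m, pderiv (Sum.inr i) (polyTimes K (insert i S) (Sum.inl m)) =
        2 * X (Sum.inr i) ^ (2 * m) := fun m => by
      have h1 : C (1 / (2 * (m : K) + 1)) * ((2 * m + 1 : ℕ) : MvPolynomial (ℕ ⊕ ℕ) K) = 1 := by
        have h5 : (2 * (m : K) + 1) ≠ 0 := by exact_mod_cast Nat.succ_ne_zero (2 * m)
        rw [← map_natCast (C : K →+* MvPolynomial (ℕ ⊕ ℕ) K), ← C_mul]
        push_cast
        rw [one_div_mul_cancel h5, C_1]
      have h2 : ∀ j ∈ S, pderiv (Sum.inr i : ℕ ⊕ ℕ) (C (1 / (2 * (m : K) + 1)) *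
          X (Sum.inr j) ^ (2 * m + 1) : MvPolynomial (ℕ ⊕ ℕ) K) = 0 := fun j hj => by
        have hji : (Sum.inr j : ℕ ⊕ ℕ) ≠ Sum.inr i := fun h => hi ((Sum.inr_injective h : j = i) ▸ hj)
        rw [pderiv_C_mul, pderiv_pow, pderiv_X_of_ne hji]
        simp
      have h3 : pderiv (Sum.inr i : ℕ ⊕ ℕ) (X (Sum.inl m) : MvPolynomial (ℕ ⊕ ℕ) K) = 0 :=
        pderiv_X_of_ne Sum.inl_ne_inr
      simp only [polyTimes, Sum.elim_inl, Finset.sum_insert hi]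
      rw [map_add, h3, ← map_ofNat C 2, pderiv_C_mul, map_add, map_sum, Finset.sum_eq_zero h2,
        pderiv_C_mul, pderiv_pow, pderiv_X_self, Nat.add_sub_cancel]
      linear_combination (C 2 * X (Sum.inr i) ^ (2 * m)) * h1
    simp only [hr, hl, mul_zero, Finset.sum_const_zero, add_zero] at h
    -- The truncated subtraction m - n is harmless: for m < n the other factor is zero.
    have hfac : ∑ m ∈ Finset.range N, aeval (polyTimes K (insert i S)) (pderiv (Sum.inl m) p) *
        (2 * X (Sum.inr i) ^ (2 * m)) = X (Sum.inr i) ^ (2 * n) *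
          ∑ m ∈ Finset.range N, aeval (polyTimes K (insert i S)) (pderiv (Sum.inl m) p) *
            (2 * X (Sum.inr i) ^ (2 * (m - n))) := by
      rw [Finset.mul_sum]
      refine Finset.sum_congr rfl fun m _ => ?_
      rcases lt_or_ge m n with hm | hm
      · rw [ih m hm]; simp
      · obtain ⟨k, rfl⟩ := Nat.exists_eq_add_of_le hm
        rw [Nat.add_sub_cancel_left]
        ring
    rw [hfac] at h
    have h6 := (mul_eq_zero.mp h.symm).resolve_left (pow_ne_zero _ (X_ne_zero _))
    have h7 := congrArg (dropParam K i) h6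
    rw [map_sum, map_zero, Finset.sum_eq_single n] at h7
    · rw [map_mul, dropParam_aeval_insert hi] at h7
      refine (mul_eq_zero.mp h7).resolve_right ?_
      rw [Nat.sub_self, mul_zero, pow_zero, mul_one, map_ofNat]
      exact two_ne_zero
    · intro m _ hmn
      rcases lt_or_gt_of_ne hmn with hm | hm
      · rw [ih m hm]; simp
      · have hX : dropParam K i (X (Sum.inr i)) = 0 := by simp [dropParam]
        rw [map_mul, map_mul, map_pow, hX, zero_pow (by omega)]
        simp
    · intro hn
      exact absurd (Finset.mem_range.mpr hnN) hn

/-- The derivative in x_{2n+1} is the sum of the partial derivatives in t_{2n+1} and t'_{2n+1}, and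
the former already vanishes. -/
theorem aeval_polyTimes_pderiv_inr {p : MvPolynomial (ℕ ⊕ ℕ) K}
    (hp : ∀ S : Finset ℕ, aeval (polyTimes K S) p = 0) (n : ℕ) (S : Finset ℕ) :
    aeval (polyTimes K S) (pderiv (Sum.inr n) p) = 0 := by
  classical
  obtain ⟨V₀, hV₀⟩ := exists_derivation_aeval (pderiv (R := K) (Sum.inl n : ℕ ⊕ ℕ))
    (polyTimes K S) p
  have h := hV₀ (V₀ ∪ {Sum.inl n, Sum.inr n}) Finset.subset_union_left
  have hg : ∀ s, pderiv (Sum.inl n) (polyTimes K S s) =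
      if s = Sum.inl n ∨ s = Sum.inr n then 1 else 0 := by
    have h0 : ∀ m : ℕ, ∀ j ∈ S, pderiv (Sum.inl n : ℕ ⊕ ℕ) (C (1 / (2 * (m : K) + 1)) *
        (X (Sum.inr j) : MvPolynomial (ℕ ⊕ ℕ) K) ^ (2 * m + 1)) = 0 := fun m j _ => by
      rw [pderiv_C_mul, pderiv_pow, pderiv_X_of_ne Sum.inr_ne_inl]
      simp
    rintro (m | m)
    · simp only [polyTimes, Sum.elim_inl]
      rw [map_add, ← map_ofNat C 2, pderiv_C_mul, map_sum, Finset.sum_eq_zero (h0 m), mul_zero,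
        add_zero, pderiv_X]
      simp [Pi.single_apply, eq_comm]
    · simp [polyTimes, pderiv_X, Pi.single_apply, eq_comm]
  rw [hp, map_zero, ← Finset.sum_subset (s₁ := {Sum.inl n, Sum.inr n}) Finset.subset_union_right]
    at h
  · rw [Finset.sum_pair Sum.inl_ne_inr] at h
    rw [aeval_polyTimes_pderiv_inl hp, hg (Sum.inr n), if_pos (Or.inr rfl), zero_mul, zero_add, mul_one] at h
    exact h.symm
  · intro s _ hs
    rw [hg, if_neg (by simpa using hs), mul_zero]

/-- The odd power sums are algebraically independent. -/
theorem eq_zero_of_aeval_polyTimes {p : MvPolynomial (ℕ ⊕ ℕ) K}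
    (hp : ∀ S : Finset ℕ, Odd S.card → aeval (polyTimes K S) p = 0) : p = 0 := by
  classical
  -- A set of even size is reached from an odd one by setting an extra parameter to 0.
  have hp' : ∀ S : Finset ℕ, aeval (polyTimes K S) p = 0 := by
    intro S
    rcases Nat.even_or_odd S.card with hS | hS
    · obtain ⟨i, hi⟩ := Infinite.exists_notMem_finset S
      rw [← dropParam_aeval_insert hi, hp _ (by
        rw [Finset.card_insert_of_notMem hi]; exact hS.add_one), map_zero]
    · exact hp S hS
  clear hp
  -- The vanishing condition is stable under all partial derivatives, so in characteristic 0 each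
  -- coefficient reduces to the constant term of an iterated derivative, which S = ∅ detects.
  have key : ∀ (m : ℕ) (d : ℕ ⊕ ℕ →₀ ℕ) (p : MvPolynomial (ℕ ⊕ ℕ) K), d.degree = m →
      (∀ S : Finset ℕ, aeval (polyTimes K S) p = 0) → coeff d p = 0 := by
    intro m
    induction m with
    | zero =>
      intro d p hd hp
      obtain rfl : d = 0 := (Finsupp.degree_eq_zero_iff d).mp hd
      have h := congrArg constantCoeff (hp ∅)
      have h2 : (constantCoeff.comp (aeval (polyTimes K (∅ : Finset ℕ))).toRingHom :
          MvPolynomial (ℕ ⊕ ℕ) K →+* K) = constantCoeff := by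
        refine MvPolynomial.ringHom_ext (fun r => by simp) fun s => ?_
        rcases s with s | s <;> simp [polyTimes]
      rw [← constantCoeff_eq, ← h2]
      simpa using h
    | succ m ih =>
      intro d p hd hp
      have hd0 : d ≠ 0 := by rintro rfl; simp at hd
      obtain ⟨s, hs⟩ := Finsupp.ne_iff.mp hd0
      have hle : Finsupp.single s 1 ≤ d := by
        rw [Finsupp.single_le_iff]; exact Nat.one_le_iff_ne_zero.mpr hs
      obtain ⟨e, rfl⟩ := exists_add_of_le hle
      have he : e.degree = m := by
        rw [map_add, Finsupp.degree_single] at hd; omega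
      have h1 : coeff e (pderiv s p) = 0 := by
        refine ih e _ he ?_
        rcases s with n | n
        · exact aeval_polyTimes_pderiv_inl hp n
        · exact aeval_polyTimes_pderiv_inr hp n
      rw [coeff_pderiv] at h1
      rw [add_comm]
      refine (mul_eq_zero.mp h1).resolve_right ?_
      exact_mod_cast Nat.succ_ne_zero (e s)
  ext d
  exact key _ d p rfl hp'

end AlgebraicIndependence

/-! ### From polynomials to power series by weighted homogeneity -/

section Transfer

open MvPolynomial

variable {K : Type*} [Field K]

/-- All weights are positive and only finitely many variables have weight at most m. Hence each
weighted component of a power series is a polynomial. -/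
theorem finite_setOf_weight_wt_eq (m : ℕ) : {d : ℕ ⊕ ℕ →₀ ℕ | Finsupp.weight wt d = m}.Finite := by
  classical
  have hwt : ∀ s, wt s ≠ 0 := by rintro (n | n) <;> simp [wt]
  refine (Set.finite_Iic (Finsupp.indicator ((Finset.range (m + 1)).disjSum
    (Finset.range (m + 1))) fun _ _ => m : ℕ ⊕ ℕ →₀ ℕ)).subset fun d hd s => ?_
  simp only [Set.mem_ofPred_eq] at hd
  rcases Nat.eq_zero_or_pos (d s) with h | h
  · rw [h]; exact Nat.zero_le _
  · have h1 := Finsupp.le_weight wt (hwt s) d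
    have h2 := Finsupp.le_weight_of_ne_zero' (w := wt) (f := d) h.ne'
    have hs : s ∈ (Finset.range (m + 1)).disjSum (Finset.range (m + 1)) := by
      rw [hd] at h2
      rcases s with n | n <;> simp [wt] at h2 ⊢ <;> omega
    rw [Finsupp.indicator_of_mem hs]
    omega

/-- The weight of `x_{2n+1}` is `2n+1`, and that of a parameter is `1`. -/
def wtParam {ι : Type*} : ℕ ⊕ ι → ℕ := Sum.elim (fun n => 2 * n + 1) (fun _ => 1)

theorem isWeightedHomogeneous_polyTimes {ι : Type*} (S : Finset ι) (s : ℕ ⊕ ℕ) :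
    IsWeightedHomogeneous wtParam (polyTimes K S s) (wt s) := by
  rcases s with n | n
  · refine (isWeightedHomogeneous_X K wtParam (Sum.inl n)).add ?_
    rw [← map_ofNat C 2]
    refine IsWeightedHomogeneous.C_mul (.sum _ _ _ fun i _ => ?_) 2
    refine IsWeightedHomogeneous.C_mul ?_ _
    have := (isWeightedHomogeneous_X K wtParam (Sum.inr i : ℕ ⊕ ι)).pow (2 * n + 1)
    simpa [wtParam] using this
  · exact isWeightedHomogeneous_X K wtParam (Sum.inl n)

theorem isWeightedHomogeneous_prod_polyTimes {ι : Type*} (S : Finset ι) (d : ℕ ⊕ ℕ →₀ ℕ) :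
    IsWeightedHomogeneous wtParam (d.prod fun s k => polyTimes K S s ^ k)
      (Finsupp.weight wt d) := by
  rw [Finsupp.weight_apply]
  exact .prod _ _ _ fun s _ => (isWeightedHomogeneous_polyTimes S s).pow (d s)

/-- The substitution preserves weight, so a coefficient of the result depends only on the component
of f of the same weight. -/
theorem coeff_subst_argTimes {ι : Type*} (S : Finset ι) (f : TwoTimes K) (e : ℕ ⊕ ι →₀ ℕ) :
    MvPowerSeries.coeff e (f.subst (argTimes K S)) =
      coeff e (aeval (polyTimes K S)
        (∑ d ∈ (finite_setOf_weight_wt_eq (Finsupp.weight wtParam e)).toFinset,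
          monomial d (MvPowerSeries.coeff d f))) := by
  have hprod : ∀ d : ℕ ⊕ ℕ →₀ ℕ, MvPowerSeries.coeff e (d.prod fun s k => argTimes K S s ^ k) =
      coeff e (d.prod fun s k => polyTimes K S s ^ k) := fun d => by
    rw [← MvPolynomial.coeff_coe, ← MvPolynomial.coeToMvPowerSeries.ringHom_apply, Finsupp.prod,
      Finsupp.prod, map_prod (MvPolynomial.coeToMvPowerSeries.ringHom)]
    simp only [map_pow, MvPolynomial.coeToMvPowerSeries.ringHom_apply, coe_polyTimes]
  rw [MvPowerSeries.coeff_subst (hasSubst_argTimes K S), map_sum, coeff_sum]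
  rw [finsum_eq_sum_of_support_subset (s :=
    (finite_setOf_weight_wt_eq (Finsupp.weight wtParam e)).toFinset)]
  · refine Finset.sum_congr rfl fun d _ => ?_
    rw [hprod, aeval_monomial, algebraMap_eq, coeff_C_mul, smul_eq_mul]
  · intro d hd
    rw [Set.Finite.coe_toFinset]
    by_contra hne
    refine hd ?_
    simp only
    rw [hprod, (isWeightedHomogeneous_prod_polyTimes S d).coeff_eq_zero e (Ne.symm hne), smul_zero]

variable [CharZero K]

theorem eq_zero_of_subst_argTimes {f : TwoTimes K}
    (hf : ∀ S : Finset ℕ, Odd S.card → f.subst (argTimes K S) = 0) : f = 0 := by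
  classical
  have hcomp : ∀ m, ∑ d ∈ (finite_setOf_weight_wt_eq m).toFinset,
      monomial d (MvPowerSeries.coeff d f) = 0 := by
    intro m
    refine eq_zero_of_aeval_polyTimes fun S hS => ?_
    ext e
    rw [coeff_zero]
    by_cases he : Finsupp.weight wtParam e = m
    · subst he
      rw [← coeff_subst_argTimes, hf S hS, MvPowerSeries.coeff_zero]
    · rw [map_sum, coeff_sum]
      refine Finset.sum_eq_zero fun d hd => ?_
      rw [Set.Finite.mem_toFinset] at hd
      rw [aeval_monomial, algebraMap_eq, coeff_C_mul,
        (isWeightedHomogeneous_prod_polyTimes S d).coeff_eq_zero e (by rwa [hd]), mul_zero]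
  ext d
  have h := congrArg (coeff d) (hcomp (Finsupp.weight wt d))
  rw [coeff_sum, Finset.sum_eq_single d] at h
  · simpa using h
  · intro e _ hed
    rw [coeff_monomial, if_neg hed]
  · intro hd
    refine absurd ?_ hd
    rw [Set.Finite.mem_toFinset, Set.mem_ofPred_eq]

end Transfer

/-! ### The four term equation as the three-point relation -/

section FourTerm

open MvPowerSeries

theorem four_term_div_iff {L : Type*} [Field L] {t a b c : L} (T₀₁₂ T₀ T₁ T₂ T₀₁ T₀₂ T₁₂ : L)
    (ht : t ≠ 0) (ha : a ≠ 0) (hb : b ≠ 0) (hc : c ≠ 0) :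
    T₀₁₂ / t = a⁻¹ * b⁻¹ * c⁻¹ * (T₀ / t * (c * (T₁₂ / t)) - T₁ / t * (b * (T₀₂ / t)) +
      T₂ / t * (a * (T₀₁ / t))) ↔
    T₀₁₂ * t = a⁻¹ * b⁻¹ * (T₀ * T₁₂) - a⁻¹ * c⁻¹ * (T₁ * T₀₂) + b⁻¹ * c⁻¹ * (T₂ * T₀₁) := by
  have h : a⁻¹ * b⁻¹ * c⁻¹ * (T₀ / t * (c * (T₁₂ / t)) - T₁ / t * (b * (T₀₂ / t)) +
      T₂ / t * (a * (T₀₁ / t))) =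
      (a⁻¹ * b⁻¹ * (T₀ * T₁₂) - a⁻¹ * c⁻¹ * (T₁ * T₀₂) + b⁻¹ * c⁻¹ * (T₂ * T₀₁)) / t / t := by
    field_simp
  rw [h, div_left_inj' ht, eq_div_iff ht]

/-- Without denominators the relation descends to the power series ring, where the parameters can be
substituted. -/
theorem cleared_iff {L : Type*} [Field L] {p₀ p₁ p₂ : L} (T A B C : L)
    (h₀₁ : p₀ ≠ p₁) (h₀₂ : p₀ ≠ p₂) (h₁₂ : p₁ ≠ p₂) :
    T = (p₀ + p₁) / (p₀ - p₁) * ((p₀ + p₂) / (p₀ - p₂)) * A +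
        (p₁ + p₀) / (p₁ - p₀) * ((p₁ + p₂) / (p₁ - p₂)) * B +
        (p₂ + p₀) / (p₂ - p₀) * ((p₂ + p₁) / (p₂ - p₁)) * C ↔
      (p₀ - p₁) * (p₀ - p₂) * (p₁ - p₂) * T =
        (p₀ + p₁) * (p₀ + p₂) * (p₁ - p₂) * A - (p₀ + p₁) * (p₁ + p₂) * (p₀ - p₂) * B +
        (p₀ + p₂) * (p₁ + p₂) * (p₀ - p₁) * C := by
  have h1 := sub_ne_zero.mpr h₀₁
  have h2 := sub_ne_zero.mpr h₀₂
  have h3 := sub_ne_zero.mpr h₁₂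
  rw [← mul_right_inj' (mul_ne_zero (mul_ne_zero h1 h2) h3), ← neg_sub p₀ p₁, ← neg_sub p₀ p₂,
    ← neg_sub p₁ p₂]
  have h : (p₀ - p₁) * (p₀ - p₂) * (p₁ - p₂) *
      ((p₀ + p₁) / (p₀ - p₁) * ((p₀ + p₂) / (p₀ - p₂)) * A +
        (p₁ + p₀) / -(p₀ - p₁) * ((p₁ + p₂) / (p₁ - p₂)) * B +
        (p₂ + p₀) / -(p₀ - p₂) * ((p₂ + p₁) / -(p₁ - p₂)) * C) =
      (p₀ + p₁) * (p₀ + p₂) * (p₁ - p₂) * A - (p₀ + p₁) * (p₁ + p₂) * (p₀ - p₂) * B +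
        (p₀ + p₂) * (p₁ + p₂) * (p₀ - p₁) * C := by
    field_simp
    ring
  rw [h]

variable {K : Type*} [Field K] {ι : Type*}

theorem argShift_insert [DecidableEq ι] {a : ι} {Q : Finset ι} (ha : a ∉ Q) (n : ℕ) :
    argShift K (insert a Q) n = argShift K Q n + 2 * bracket (X (Sum.inr a)) n := by
  rw [argShift, argShift, Finset.sum_insert ha]; ring

/-- Setting all parameters to 0 recovers τ. -/
theorem subst_argShift_ne_zero {τ : MvPowerSeries ℕ K} (hτ : τ ≠ 0) (S : Finset ι) :
    τ.subst (argShift K S) ≠ 0 := by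
  have hh : HasSubst (Sum.elim X (fun _ : ι => 0) : ℕ ⊕ ι → MvPowerSeries ℕ K) :=
    hasSubst_sumElim HasSubst.X HasSubst.zero
  intro h
  apply hτ
  have h1 := subst_comp_subst_apply (hasSubst_argShift K S) hh τ
  have h2 : (fun n => (argShift K S n).subst
      (Sum.elim X (fun _ : ι => 0) : ℕ ⊕ ι → MvPowerSeries ℕ K)) = X := by
    funext n
    rw [subst_argShift hh]
    simp [bracket_zero]
  rw [h, h2, subst_self, id, ← substAlgHom_apply hh, map_zero] at h1
  exact h1.symm

theorem shiftTau_ne_zero {τ : MvPowerSeries ℕ K} (hτ : τ ≠ 0) (S : Finset ι) :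
    shiftTau τ S ≠ 0 := fun h => subst_argShift_ne_zero hτ S
  (FaithfulSMul.algebraMap_injective _ (FractionRing (MvPowerSeries (ℕ ⊕ ι) K))
    (h.trans (map_zero _).symm))

theorem shiftTau_empty (τ : MvPowerSeries ℕ K) : shiftTau τ (∅ : Finset ι) =
    algebraMap (MvPowerSeries (ℕ ⊕ ι) K) _ (τ.subst fun n => X (Sum.inl n)) := by
  rw [shiftTau, funext (argShift_empty (K := K) (ι := ι))]

/-- The relation between the shifts of `τ` by subsets of `S`. -/
def PointRelation [DecidableEq ι] (τ : MvPowerSeries ℕ K) (S : Finset ι) : Prop :=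
  ∑ i ∈ S, (∏ j ∈ S.erase i, ratioParam K i j) * (shiftTau τ (S.erase i) * shiftTau τ {i}) =
    shiftTau τ S * shiftTau τ ∅

theorem param_add_ne_zero {i j : ι} (hij : i ≠ j) : param K i + param K j ≠ 0 := by
  classical
  intro h
  have h2 : (X (Sum.inr i) + X (Sum.inr j) : MvPowerSeries (ℕ ⊕ ι) K) = 0 :=
    FaithfulSMul.algebraMap_injective _ (FractionRing (MvPowerSeries (ℕ ⊕ ι) K))
      (by rw [map_add, map_zero]; exact h)
  have := congrArg (coeff (Finsupp.single (Sum.inr i) 1)) h2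
  rw [map_add, coeff_index_single_self_X, coeff_index_single_X, if_neg (by simpa using hij),
    coeff_zero, add_zero] at this
  exact one_ne_zero this

theorem pointRelation_three_iff {a b c : ι} [DecidableEq ι] (τ : MvPowerSeries ℕ K) (hab : a ≠ b)
    (hac : a ≠ c) (hbc : b ≠ c) : PointRelation τ {a, b, c} ↔
      shiftTau τ {a, b, c} * shiftTau τ ∅ =
        ratioParam K a b * ratioParam K a c * (shiftTau τ {a} * shiftTau τ {b, c}) +
        ratioParam K b a * ratioParam K b c * (shiftTau τ {b} * shiftTau τ {a, c}) +
        ratioParam K c a * ratioParam K c b * (shiftTau τ {c} * shiftTau τ {a, b}) := by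
  have h1 : ({a, b, c} : Finset ι).erase a = {b, c} := by grind
  have h2 : ({a, b, c} : Finset ι).erase b = {a, c} := by grind
  have h3 : ({a, b, c} : Finset ι).erase c = {a, b} := by grind
  rw [PointRelation, Finset.sum_insert (by simp [hab, hac]), Finset.sum_pair hbc, h1, h2, h3,
    Finset.prod_pair hbc, Finset.prod_pair hac, Finset.prod_pair hab, eq_comm]
  ring_nf

/-- In each term of the four term equation, one factor of A₁₂₃ cancels against `coef`; antisymmetry
of `ratioParam` accounts for the minus sign. -/
theorem fourTermEquation_iff {τ : MvPowerSeries ℕ K} (hτ : τ ≠ 0) :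
    FourTermEquation τ ↔ PointRelation τ ({0, 1, 2} : Finset (Fin 3)) := by
  have hratio : ∀ S : Finset (Fin 3), ratio τ S = shiftTau τ S / shiftTau τ ∅ := fun S => by
    rw [shiftTau_empty]; rfl
  have hcoef : ∀ i j : Fin 3, coef K i j = (ratioParam K i j)⁻¹ := fun i j => by
    rw [coef, ratioParam, inv_div, map_sub, map_add]; rfl
  have hne : ∀ i j : Fin 3, i ≠ j → ratioParam K i j ≠ 0 := fun i j hij =>
    div_ne_zero (param_add_ne_zero hij) (sub_ne_zero.mpr (param_injective.ne hij))
  rw [pointRelation_three_iff τ (by decide) (by decide) (by decide), FourTermEquation]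
  simp only [hratio, hcoef]
  rw [four_term_div_iff _ _ _ _ _ _ _ (shiftTau_ne_zero hτ ∅)
    (inv_ne_zero (hne 0 1 (by decide))) (inv_ne_zero (hne 0 2 (by decide)))
    (inv_ne_zero (hne 1 2 (by decide)))]
  simp only [inv_inv]
  rw [ratioParam_antisymm 1 0, ratioParam_antisymm 2 0, ratioParam_antisymm 2 1]
  ring_nf

/-- The four term equation at a shifted argument and at arbitrary parameters. -/
theorem FourTermEquation.shift {τ : MvPowerSeries ℕ K} (hτ : τ ≠ 0) (h : FourTermEquation τ)
    [DecidableEq ι] (Q : Finset ι) (a b c : ι) (hab : a ≠ b) (hac : a ≠ c) (hbc : b ≠ c)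
    (ha : a ∉ Q) (hb : b ∉ Q) (hc : c ∉ Q) :
    shiftTau τ (insert a (insert b (insert c Q))) * shiftTau τ Q =
      ratioParam K a b * ratioParam K a c *
        (shiftTau τ (insert a Q) * shiftTau τ (insert b (insert c Q))) +
      ratioParam K b a * ratioParam K b c *
        (shiftTau τ (insert b Q) * shiftTau τ (insert a (insert c Q))) +
      ratioParam K c a * ratioParam K c b *
        (shiftTau τ (insert c Q) * shiftTau τ (insert a (insert b Q))) := by
  rw [fourTermEquation_iff hτ, pointRelation_three_iff τ (by decide) (by decide) (by decide)] at h
  simp only [ratioParam] at h ⊢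
  rw [cleared_iff _ _ _ _ (param_injective.ne (by decide)) (param_injective.ne (by decide))
    (param_injective.ne (by decide))] at h
  rw [cleared_iff _ _ _ _ (param_injective.ne hab) (param_injective.ne hac)
    (param_injective.ne hbc)]
  simp only [shiftTau, param, ← map_mul, ← map_add, ← map_sub] at h ⊢
  replace h := FaithfulSMul.algebraMap_injective _ _ h
  congr 1
  -- The substitution x ↦ x + 2 ∑_{i ∈ Q} [α_i]ₒ, (α₁, α₂, α₃) ↦ (α_a, α_b, α_c).
  set f : Fin 3 → MvPowerSeries (ℕ ⊕ ι) K := ![X (Sum.inr a), X (Sum.inr b), X (Sum.inr c)]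
  have hsub : HasSubst (Sum.elim (argShift K Q) f) := by
    refine hasSubst_sumElim (hasSubst_argShift K Q) (hasSubst_of_constantCoeff_zero fun i => ?_)
    fin_cases i <;> simp [f]
  have hshift : ∀ S : Finset (Fin 3), (τ.subst (argShift K S)).subst (Sum.elim (argShift K Q) f) =
      τ.subst (fun n => argShift K Q n + 2 * ∑ i ∈ S, bracket (f i) n) := fun S => by
    rw [subst_comp_subst_apply (hasSubst_argShift K S) hsub]
    simp only [subst_argShift hsub, Sum.elim_inl, Sum.elim_inr]
  have hX : ∀ i : Fin 3, (X (Sum.inr i) : ThreePoint K).subst (Sum.elim (argShift K Q) f) = f i :=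
    fun i => by rw [subst_X hsub, Sum.elim_inr]
  have h' := congrArg (subst (Sum.elim (argShift K Q) f)) h
  rw [← substAlgHom_apply hsub, ← substAlgHom_apply hsub] at h'
  simp only [map_mul, map_add, map_sub, substAlgHom_apply, hshift, hX] at h'
  have hf0 : f 0 = X (Sum.inr a) := rfl
  have hf1 : f 1 = X (Sum.inr b) := rfl
  have hf2 : f 2 = X (Sum.inr c) := rfl
  have e012 : (fun n => argShift K Q n + 2 * ∑ i ∈ ({0, 1, 2} : Finset (Fin 3)), bracket (f i) n) =
      argShift K (insert a (insert b (insert c Q))) := by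
    funext n
    rw [argShift_insert (by simp [hab, hac, ha]), argShift_insert (by simp [hbc, hb]),
      argShift_insert hc, Finset.sum_insert (by decide), Finset.sum_pair (by decide), hf0, hf1, hf2]
    ring
  have epair : ∀ (i j : Fin 3) (p q : ι), i ≠ j → p ≠ q → p ∉ Q → q ∉ Q → f i = X (Sum.inr p) →
      f j = X (Sum.inr q) →
      (fun n => argShift K Q n + 2 * ∑ k ∈ ({i, j} : Finset (Fin 3)), bracket (f k) n) =
        argShift K (insert p (insert q Q)) := by
    intro i j p q hij hpq hp hq hi hj
    funext n
    rw [argShift_insert (by simp [hpq, hp]), argShift_insert hq, Finset.sum_pair hij, hi, hj]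
    ring
  have esingle : ∀ (i : Fin 3) (p : ι), p ∉ Q → f i = X (Sum.inr p) →
      (fun n => argShift K Q n + 2 * ∑ k ∈ ({i} : Finset (Fin 3)), bracket (f k) n) =
        argShift K (insert p Q) := by
    intro i p hp hi
    funext n
    rw [argShift_insert hp, Finset.sum_singleton, hi]
  have eempty : (fun n => argShift K Q n + 2 * ∑ k ∈ (∅ : Finset (Fin 3)), bracket (f k) n) =
      argShift K Q := by
    funext n; simp
  rwa [e012, eempty, epair 0 1 a b (by decide) hab ha hb hf0 hf1,
    epair 0 2 a c (by decide) hac ha hc hf0 hf2, epair 1 2 b c (by decide) hbc hb hc hf1 hf2,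
    esingle 0 a ha hf0, esingle 1 b hb hf1, esingle 2 c hc hf2, hf0, hf1, hf2] at h'

variable [CharZero K]

/-- The constant partial fraction contributes -T(S) T(∅) and the right side of the hierarchy T(S)
T(∅), so the specialized hierarchy is twice the point relation. -/
theorem subst_eq_zero_iff_pointRelation [DecidableEq ι] {S : Finset ι} (hS : Odd S.card)
    (τ : MvPowerSeries ℕ K) :
    (residue (expXi K) (tauTau τ) - τ.subst (fun n => (X (Sum.inl n) : TwoTimes K)) *
      τ.subst (fun n => (X (Sum.inr n) : TwoTimes K))).subst (argTimes K S) = 0 ↔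
      PointRelation τ S := by
  have hinj : Function.Injective (algebraMap (MvPowerSeries (ℕ ⊕ ι) K)
    (FractionRing (MvPowerSeries (ℕ ⊕ ι) K))) := FaithfulSMul.algebraMap_injective _ _
  have hsub := hasSubst_argTimes K S
  have h1 : (τ.subst (fun n => (X (Sum.inl n) : TwoTimes K))).subst (argTimes K S) =
      τ.subst (argShift K S) := by
    rw [subst_comp_subst_apply (hasSubst_X Sum.inl_injective) hsub]
    simp only [subst_X hsub]
    rfl
  have h2 : (τ.subst (fun n => (X (Sum.inr n) : TwoTimes K))).subst (argTimes K S) =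
      τ.subst (argShift K (∅ : Finset ι)) := by
    rw [subst_comp_subst_apply (hasSubst_X Sum.inr_injective) hsub]
    simp only [subst_X hsub]
    rw [funext (argShift_empty (K := K) (ι := ι))]
    rfl
  rw [subst_sub hsub, subst_mul hsub, h1, h2, ← map_eq_zero_iff _ hinj, map_sub,
    algebraMap_subst_residue hS, map_mul, PointRelation]
  simp only [mul_assoc, ← Finset.mul_sum]
  change -(shiftTau τ S * shiftTau τ ∅) + 2 * _ - shiftTau τ S * shiftTau τ ∅ = 0 ↔ _
  have h3 : (2 : FractionRing (MvPowerSeries (ℕ ⊕ ι) K)) ≠ 0 := by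
    have : (2 : MvPowerSeries (ℕ ⊕ ι) K) ≠ 0 := fun h => by
      have := congrArg constantCoeff h
      rw [map_ofNat, map_zero] at this
      exact two_ne_zero this
    intro h
    exact this (hinj (by rw [map_ofNat, map_zero]; exact h))
  constructor
  · intro h
    refine mul_left_cancel₀ h3 ?_
    linear_combination h
  · intro h
    linear_combination 2 * h

end FourTerm

end BKP

theorem theorem3 {K : Type*} [Field K] [CharZero K] (τ : MvPowerSeries ℕ K) (hτ : τ ≠ 0) :
    BKP.FourTermEquation τ ↔ BKP.IsBKP τ := by
  rw [BKP.IsBKP, ← sub_eq_zero]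
  constructor
  · intro h
    refine BKP.eq_zero_of_subst_argTimes fun S hS => ?_
    rw [BKP.subst_eq_zero_iff_pointRelation hS]
    obtain ⟨n, hn⟩ := hS
    exact BKP.odd_point BKP.ratioParam_antisymm (BKP.shiftTau_ne_zero hτ) (h.shift hτ) n S hn
  · intro h
    rw [BKP.fourTermEquation_iff hτ, ← BKP.subst_eq_zero_iff_pointRelation (by decide), h,
      ← MvPowerSeries.substAlgHom_apply (BKP.hasSubst_argTimes K _), map_zero]
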